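/- Let $d\ge 1$ and $N\ge 0$ be integers, and let $\mathcal{DU}_n$ denote the set of diagonal unitary $n\times n$ matrices. For a unitary $V\in\mathcal U_n$ let $\Phi_V(\sigma)=V\sigma V^\dagger$ be the unitary channel of $V$, and let $\mathcal P_V(\sigma)=\sum_{i=1}^n \langle i|V^\dagger\sigma V|i\rangle\,|i\rangle\langle i|$ be the von Neumann measurement in the orthonormal basis formed by the columns of $V$, regarded as a channel; $\mathbf 1$ is the identity matrix of the appropriate size. For a linear map $S$ on $n\times n$ matrices let $\|S\|_\diamond=\max_{\|X\|_1=1}\|(S\otimes\mathrm{id})(X)\|_1$ be its diamond norm, where $\|\cdot\|_1$ is the trace norm, $\mathrm{id}$ is the identity map on $n\times n$ matrices and $X$ ranges over $n^2\times n^2$ complex matrices. Then for every unitary $U\in\mathcal U_d$, $$\big\|\mathcal P_{U^{\otimes N}}-\mathcal P_{\mathbf 1}\big\|_\diamond=\min_{E\in\mathcal{DU}_d}\big\|\Phi_{U^{\otimes N}E^{\otimes N}}-\Phi_{\mathbf 1}\big\|_\diamond ,$$ and the minimum is attained. Moreover, this value equals $\min_{F\in\mathcal{DU}_{d^N}}\|\Phi_{U^{\otimes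 N}F}-\Phi_{\mathbf 1}\|_\diamond$; that is, an optimal diagonal unitary $F$ for the $N$-fold parallel scheme can be taken of the tensor-product form $E^{\otimes N}$ with $E\in\mathcal{DU}_d$. -/

import Mathlib

open scoped Matrix

noncomputable section

namespace VonNeumannDiscrimination

/-- The trace norm `‖X‖₁ = tr √(X† X)`: the sum of the singular values of `X`, that is, of the
square roots of the eigenvalues (with multiplicity) of `X† X`. -/
def traceNorm {n : Type*} [Fintype n] [DecidableEq n] (X : Matrix n n ℂ) : ℝ :=
  ∑ i, Real.sqrt ((Matrix.isHermitian_conjTranspose_mul_self X).eigenvalues i)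

/-- The map `S ⊗ 1` on `L(ℂᵐ) ⊗ L(ℂᵏ)`: `S` is applied to each of the blocks
`(X (i, a) (j, b))_{i, j}` of `X`. -/
def ampliate {m n k : Type*} (S : Matrix m m ℂ →ₗ[ℂ] Matrix n n ℂ)
    (X : Matrix (m × k) (m × k) ℂ) :
    Matrix (n × k) (n × k) ℂ :=
  fun p q => S (fun i j => X (i, p.2) (j, q.2)) p.1 q.1

/-- The diamond norm `‖S‖⋄ = max_{‖X‖₁ = 1} ‖(S ⊗ 1)(X)‖₁`, where the identity acts on an
ancilla of the same dimension as the input space of `S`. -/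
def diamondNorm {m n : Type*} [Fintype m] [DecidableEq m] [Fintype n] [DecidableEq n]
    (S : Matrix m m ℂ →ₗ[ℂ] Matrix n n ℂ) : ℝ :=
  sSup {r : ℝ | ∃ X : Matrix (m × m) (m × m) ℂ, traceNorm X = 1 ∧ r = traceNorm (ampliate S X)}

/-- The measure-and-prepare map `σ ↦ ∑ i, tr(M i σ) |i⟩⟨i|` of a measurement with effects `M i`. -/
def measurementChannel {n : Type*} [Fintype n] [DecidableEq n] (M : n → Matrix n n ℂ) :
    Matrix n n ℂ →ₗ[ℂ] Matrix n n ℂ where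
  toFun σ := ∑ i, (M i * σ).trace • Matrix.single i i (1 : ℂ)
  map_add' σ τ := by
    simp only [Matrix.mul_add, Matrix.trace_add, add_smul, Finset.sum_add_distrib]
  map_smul' c σ := by
    simp only [Matrix.mul_smul, Matrix.trace_smul, smul_eq_mul, mul_smul, Finset.smul_sum,
      RingHom.id_apply]

/-- The rank-one operators `|ψ i⟩⟨ψ i|`, where `ψ i = U |i⟩` is the `i`-th column of `U`. -/
def columnProjector {n : Type*} (U : Matrix n n ℂ) (i : n) : Matrix n n ℂ :=
  Matrix.vecMulVec (fun a => U a i) (fun b => star (U b i))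

/-- The von Neumann measurement `P_U` in the basis formed by the columns of `U`, as a channel with
classical output. -/
def vonNeumannMeasurement {n : Type*} [Fintype n] [DecidableEq n] (U : Matrix n n ℂ) :
    Matrix n n ℂ →ₗ[ℂ] Matrix n n ℂ :=
  measurementChannel (columnProjector U)

/-- The unitary channel `Φ_U : σ ↦ U σ U†`. -/
def unitaryChannel {n : Type*} [Fintype n] (U : Matrix n n ℂ) :
    Matrix n n ℂ →ₗ[ℂ] Matrix n n ℂ where
  toFun σ := U * σ * Uᴴ
  map_add' σ τ := by rw [Matrix.mul_add, Matrix.add_mul]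
  map_smul' c σ := by simp only [Matrix.mul_smul, Matrix.smul_mul, RingHom.id_apply]

/-- The tensor power `A^{⊗N}`, written in the product basis `|f 0⟩ ⊗ ⋯ ⊗ |f (N - 1)⟩` of
`(ℂⁿ)^{⊗N}`, which is indexed by the functions `f : Fin N → n`. -/
def tensorPower {n : Type*} (N : ℕ) (A : Matrix n n ℂ) : Matrix (Fin N → n) (Fin N → n) ℂ :=
  fun f g => ∏ t, A (f t) (g t)

/-- The set of diagonal unitary matrices. -/
def diagonalUnitary (n : Type*) [Fintype n] [DecidableEq n] : Set (Matrix n n ℂ) :=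
  {E | E ∈ Matrix.unitaryGroup n ℂ ∧ E.IsDiag}

end VonNeumannDiscrimination

end

noncomputable section

namespace VonNeumannDiscrimination

open scoped ComplexOrder Kronecker Matrix.Norms.L2Operator

/-! ### Trace norm: duality with the operator norm -/

section TraceNorm

variable {n : Type*} [Fintype n] [DecidableEq n]

/-! Upper bound. The measurement `P_V` is the channel of `Vᴴ` followed by dephasing, and it does not
change when `V` is replaced by `V F` with `F` diagonal unitary. Dephasing contracts the trace norm,
and undoing a unitary does not increase it, so `‖P_V - P_1‖ ≤ ‖Φ_{VF} - Φ_1‖` for every `F`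
(`diamondNorm_vonNeumannMeasurement_sub_le`). It remains to find one `E`, acting on a single copy,
for which `F = E^{⊗N}` gives the reverse inequality; this settles both minima at once.

Choice of `E` (`exists_optimal_diagonalUnitary`). Let `ν` be the minimum of `∑ |(ρU)_ii|` over
states, attained at `ρ`. If `ν = 0`, then for `N > 0` a purification of `ρ^{⊗N}` makes the two
measurements perfectly distinguishable. If `ν > 0`, separating the ℓ¹ ball of radius `ν` from the
convex set of diagonals of `σU` yields a diagonal contraction; its phases form `E`, and every
eigenvalue of `W = U E` has real part at least `ν = cos θ`. Complementary slackness places `ρ` on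
the extreme eigenspaces, with eigenvalues `e^{±iθ}`, and makes the diagonal of `ρW` real.
Compressing `ρ` to these two eigenspaces then gives states `ρ₁`, `ρ₂` with equal diagonals
(`exists_extremal_states`).

Tensor powers. Products of `k` copies of `ρ₁` and `N - k` of `ρ₂` all have the same diagonal and
have phase `(2k - N)θ` under `W^{⊗N}`, so mixing them mixes the phases. A mixture with overlap `c`
gives the lower bound `2√(1 - c²)` for the measurements. If `Nθ ≤ π/2`, the overlap `cos Nθ` is
reached, and `2 sin Nθ` is also an upper bound for the unitary channels, since the spectrum of
`W^{⊗N}` lies in the disc of centre `cos Nθ` and radius `sin Nθ`. If `Nθ ≥ π/2`, the overlap `0` is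
reached and both norms are `2`. -/

lemma norm_star_dotProduct_mulVec_le (M : Matrix n n ℂ) (v w : n → ℂ) :
    ‖star v ⬝ᵥ (M *ᵥ w)‖ ≤ ‖M‖ * ‖WithLp.toLp 2 v‖ * ‖WithLp.toLp 2 w‖ := by
  have h : star v ⬝ᵥ (M *ᵥ w) = inner ℂ (WithLp.toLp 2 v) (WithLp.toLp 2 (M *ᵥ w)) := by
    rw [EuclideanSpace.inner_eq_star_dotProduct, dotProduct_comm]
  rw [h]
  refine (norm_inner_le_norm _ _).trans ?_
  have := Matrix.l2_opNorm_mulVec M (WithLp.toLp 2 w)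
  calc _ ≤ ‖WithLp.toLp 2 v‖ * (‖M‖ * ‖WithLp.toLp 2 w‖) := by gcongr; exact this
    _ = _ := by ring

omit [DecidableEq n] in
lemma norm_toLp_sq (v : n → ℂ) : ((‖WithLp.toLp 2 v‖ ^ 2 : ℝ) : ℂ) = star v ⬝ᵥ v := by
  have := inner_self_eq_norm_sq_to_K (𝕜 := ℂ) (WithLp.toLp 2 v)
  rw [EuclideanSpace.inner_eq_star_dotProduct, dotProduct_comm] at this
  rw [this]; push_cast; rfl

lemma norm_le_one_of_norm_mul_star_le {M : Matrix n n ℂ} (h : ‖M * Mᴴ‖ ≤ 1) : ‖M‖ ≤ 1 := by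
  have h2 := CStarRing.norm_self_mul_star (x := M)
  rw [Matrix.star_eq_conjTranspose] at h2
  nlinarith [norm_nonneg M]

lemma norm_diagonal_le {v : n → ℂ} {r : ℝ} (hr : 0 ≤ r) (h : ∀ i, ‖v i‖ ≤ r) :
    ‖Matrix.diagonal v‖ ≤ r := by
  rw [Matrix.l2_opNorm_diagonal]
  exact (pi_norm_le_iff_of_nonneg hr).2 h

lemma norm_one_le : ‖(1 : Matrix n n ℂ)‖ ≤ 1 := by
  rw [← Matrix.diagonal_one]
  exact norm_diagonal_le zero_le_one (by simp)

lemma norm_le_one_of_mem_unitaryGroup {Q : Matrix n n ℂ} (hQ : Q ∈ Matrix.unitaryGroup n ℂ) :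
    ‖Q‖ ≤ 1 := by
  apply norm_le_one_of_norm_mul_star_le
  rw [← Matrix.star_eq_conjTranspose, Unitary.mul_star_self_of_mem hQ]
  exact norm_one_le

lemma norm_mul_mul_star_le {Q : Matrix n n ℂ} (hQ : Q ∈ Matrix.unitaryGroup n ℂ)
    (A : Matrix n n ℂ) : ‖Q * A * Qᴴ‖ ≤ ‖A‖ := by
  have h1 := norm_le_one_of_mem_unitaryGroup hQ
  have h2 : ‖Qᴴ‖ ≤ 1 := norm_le_one_of_mem_unitaryGroup (Unitary.star_mem hQ)
  calc ‖Q * A * Qᴴ‖ ≤ ‖Q‖ * ‖A‖ * ‖Qᴴ‖ :=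
        (norm_mul_le _ _).trans (by gcongr; exact norm_mul_le _ _)
    _ ≤ 1 * ‖A‖ * 1 := by gcongr
    _ = ‖A‖ := by ring

lemma conj_mul_conj {Q : Matrix n n ℂ} (hQ : Q ∈ Matrix.unitaryGroup n ℂ)
    (A B : Matrix n n ℂ) : (Q * A * Qᴴ) * (Q * B * Qᴴ) = Q * (A * B) * Qᴴ := by
  have : Qᴴ * Q = 1 := Unitary.star_mul_self_of_mem hQ
  calc _ = Q * A * (Qᴴ * Q) * B * Qᴴ := by simp only [mul_assoc]
    _ = _ := by rw [this]; simp only [mul_assoc, one_mul]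

/-- Expand the trace in an orthonormal eigenbasis `u i` of `Xᴴ X`, where `‖X u i‖` is the `i`-th
singular value. With the next theorem this is the duality through which all trace norms are
estimated. -/
theorem norm_trace_mul_le (M X : Matrix n n ℂ) : ‖(M * X).trace‖ ≤ ‖M‖ * traceNorm X := by
  set hX := Matrix.isHermitian_conjTranspose_mul_self X
  set Q := hX.eigenvectorUnitary
  have h1 : (M * X).trace = ((Q : Matrix n n ℂ)ᴴ * (M * X) * Q).trace := by
    rw [Matrix.trace_mul_cycle]
    have : (Q : Matrix n n ℂ) * (Q : Matrix n n ℂ)ᴴ = 1 := Unitary.mul_star_self_of_mem Q.2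
    rw [this, one_mul]
  have h2 (i) : ((Q : Matrix n n ℂ)ᴴ * (M * X) * Q) i i =
      star (WithLp.ofLp (hX.eigenvectorBasis i)) ⬝ᵥ
        (M *ᵥ (X *ᵥ (WithLp.ofLp (hX.eigenvectorBasis i)))) := by
    rw [Matrix.mulVec_mulVec, Matrix.dotProduct_mulVec]
    rfl
  have h3 (i) : ‖WithLp.toLp 2 (X *ᵥ (WithLp.ofLp (hX.eigenvectorBasis i)))‖ =
      Real.sqrt (hX.eigenvalues i) := by
    have h := norm_toLp_sq (X *ᵥ (WithLp.ofLp (hX.eigenvectorBasis i)))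
    rw [Matrix.star_mulVec, Matrix.dotProduct_mulVec, Matrix.vecMul_vecMul,
      ← Matrix.dotProduct_mulVec] at h
    have he := hX.eigenvalues_eq i
    rw [he, ← h]
    rw [RCLike.re_eq_complex_re, Complex.ofReal_re, Real.sqrt_sq (norm_nonneg _)]
  rw [h1, Matrix.trace, traceNorm, Finset.mul_sum]
  refine (norm_sum_le _ _).trans (Finset.sum_le_sum fun i _ => ?_)
  rw [Matrix.diag_apply, h2]
  refine (norm_star_dotProduct_mulVec_le _ _ _).trans ?_
  rw [h3]
  have : ‖WithLp.toLp 2 (WithLp.ofLp (hX.eigenvectorBasis i))‖ = 1 :=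
    hX.eigenvectorBasis.orthonormal.1 i
  rw [this, mul_one]

theorem exists_trace_mul_eq_traceNorm (X : Matrix n n ℂ) :
    ∃ M : Matrix n n ℂ, ‖M‖ ≤ 1 ∧ (M * X).trace = (traceNorm X : ℂ) := by
  set hX := Matrix.isHermitian_conjTranspose_mul_self X
  obtain ⟨Q, hQu, hs⟩ : ∃ Q ∈ Matrix.unitaryGroup n ℂ,
      Xᴴ * X = Q * Matrix.diagonal (fun i => (hX.eigenvalues i : ℂ)) * Qᴴ :=
    ⟨hX.eigenvectorUnitary, hX.eigenvectorUnitary.2, hX.spectral_theorem⟩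
  set l := hX.eigenvalues
  have hQ : Qᴴ * Q = 1 := Unitary.star_mul_self_of_mem hQu
  -- The dual witness is the pseudo-inverse of `√(Xᴴ X)` times `Xᴴ`; the convention `0⁻¹ = 0` takes
  -- care of the kernel.
  set g : n → ℂ := fun i => ((Real.sqrt (l i))⁻¹ : ℝ)
  have hg (i) : g i * l i = (Real.sqrt (l i) : ℝ) := by
    simp only [g]
    rw [← Complex.ofReal_mul, inv_mul_eq_div, Real.div_sqrt]
  have hG : (Q * Matrix.diagonal g * Qᴴ)ᴴ = Q * Matrix.diagonal g * Qᴴ := by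
    simp only [Matrix.conjTranspose_mul, Matrix.conjTranspose_conjTranspose,
      Matrix.diagonal_conjTranspose, mul_assoc]
    congr 3
    ext i
    simp [g]
  refine ⟨Q * Matrix.diagonal g * Qᴴ * Xᴴ, norm_le_one_of_norm_mul_star_le ?_, ?_⟩
  · have h : (Q * Matrix.diagonal g * Qᴴ * Xᴴ) * (Q * Matrix.diagonal g * Qᴴ * Xᴴ)ᴴ =
        Q * Matrix.diagonal (fun i => g i * l i * g i) * Qᴴ := by
      rw [Matrix.conjTranspose_mul, hG, Matrix.conjTranspose_conjTranspose, ← mul_assoc,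
        mul_assoc _ Xᴴ X, hs, conj_mul_conj hQu, conj_mul_conj hQu, Matrix.diagonal_mul_diagonal,
        Matrix.diagonal_mul_diagonal]
    rw [h]
    refine (norm_mul_mul_star_le hQu _).trans (norm_diagonal_le zero_le_one fun i => ?_)
    rw [hg]
    simp only [g]
    rw [← Complex.ofReal_mul, Complex.norm_real, Real.norm_of_nonneg (by positivity)]
    exact mul_inv_le_one
  · rw [mul_assoc _ Xᴴ X, hs, conj_mul_conj hQu, Matrix.diagonal_mul_diagonal,
      Matrix.trace_mul_cycle, hQ, one_mul, Matrix.trace_diagonal]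
    simp only [hg, traceNorm]
    push_cast
    rfl

lemma traceNorm_nonneg (X : Matrix n n ℂ) : 0 ≤ traceNorm X :=
  Finset.sum_nonneg fun _ _ => Real.sqrt_nonneg _

lemma re_trace_mul_le_traceNorm {M : Matrix n n ℂ} (hM : ‖M‖ ≤ 1) (X : Matrix n n ℂ) :
    (M * X).trace.re ≤ traceNorm X :=
  (Complex.re_le_norm _).trans <| (norm_trace_mul_le M X).trans <|
    mul_le_of_le_one_left (traceNorm_nonneg X) hM

theorem traceNorm_mul_mul_le (A X B : Matrix n n ℂ) :
    traceNorm (A * X * B) ≤ ‖A‖ * ‖B‖ * traceNorm X := by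
  obtain ⟨M, hM, h⟩ := exists_trace_mul_eq_traceNorm (A * X * B)
  have h1 : (M * (A * X * B)).trace = (B * M * A * X).trace := by
    rw [← mul_assoc, Matrix.trace_mul_comm, ← mul_assoc, ← mul_assoc]
  have h2 := norm_trace_mul_le (B * M * A) X
  rw [← h1, h, Complex.norm_real, Real.norm_of_nonneg (traceNorm_nonneg _)] at h2
  refine h2.trans (mul_le_mul_of_nonneg_right ?_ (traceNorm_nonneg X))
  calc ‖B * M * A‖ ≤ ‖B‖ * ‖M‖ * ‖A‖ :=
        (norm_mul_le _ _).trans (by gcongr; exact norm_mul_le _ _)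
    _ ≤ ‖B‖ * 1 * ‖A‖ := by gcongr
    _ = ‖A‖ * ‖B‖ := by ring

theorem traceNorm_add_le (X Y : Matrix n n ℂ) :
    traceNorm (X + Y) ≤ traceNorm X + traceNorm Y := by
  obtain ⟨M, hM, h⟩ := exists_trace_mul_eq_traceNorm (X + Y)
  have h1 : traceNorm (X + Y) = (M * X).trace.re + (M * Y).trace.re := by
    rw [← Complex.ofReal_re (traceNorm (X + Y)), ← h, mul_add, Matrix.trace_add, Complex.add_re]
  rw [h1]
  exact add_le_add (re_trace_mul_le_traceNorm hM X) (re_trace_mul_le_traceNorm hM Y)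

theorem traceNorm_vecMulVec_star (v : n → ℂ) :
    traceNorm (Matrix.vecMulVec v (star v)) = ‖WithLp.toLp 2 v‖ ^ 2 := by
  have key (M : Matrix n n ℂ) :
      (M * Matrix.vecMulVec v (star v)).trace = star v ⬝ᵥ (M *ᵥ v) := by
    rw [Matrix.mul_vecMulVec, Matrix.trace_vecMulVec, dotProduct_comm]
  apply le_antisymm
  · obtain ⟨M, hM, h⟩ := exists_trace_mul_eq_traceNorm (Matrix.vecMulVec v (star v))
    have h2 := norm_star_dotProduct_mulVec_le M v v
    rw [← key, h, Complex.norm_real, Real.norm_of_nonneg (traceNorm_nonneg _)] at h2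
    nlinarith [norm_nonneg (WithLp.toLp 2 v), sq_nonneg ‖WithLp.toLp 2 v‖]
  · have h := norm_trace_mul_le 1 (Matrix.vecMulVec v (star v))
    rw [key, Matrix.one_mulVec, ← norm_toLp_sq, Complex.norm_real,
      Real.norm_of_nonneg (sq_nonneg _)] at h
    refine h.trans (mul_le_of_le_one_left (traceNorm_nonneg _) ?_)
    exact norm_one_le

end TraceNorm

/-! ### Dephasing, and upper bounds for diamond norms -/

section Upper

variable {n k : Type*} [Fintype n] [DecidableEq n] [Fintype k] [DecidableEq k]

lemma norm_le_of_sum_sq_le {A : Matrix n n ℂ} {C : ℝ} (hC : 0 ≤ C)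
    (h : ∀ x : n → ℂ, ∑ i, ‖(A *ᵥ x) i‖ ^ 2 ≤ C ^ 2 * ∑ i, ‖x i‖ ^ 2) : ‖A‖ ≤ C := by
  rw [Matrix.cstar_norm_def]
  refine ContinuousLinearMap.opNorm_le_bound _ hC fun x => ?_
  rw [← abs_of_nonneg (norm_nonneg (Matrix.toEuclideanCLM (n := n) (𝕜 := ℂ) A x)),
    ← abs_of_nonneg (mul_nonneg hC (norm_nonneg x)), ← sq_le_sq, mul_pow,
    EuclideanSpace.norm_sq_eq, EuclideanSpace.norm_sq_eq]
  exact h x.ofLp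

lemma sum_sq_mulVec_le (A : Matrix n n ℂ) (x : n → ℂ) :
    ∑ i, ‖(A *ᵥ x) i‖ ^ 2 ≤ ‖A‖ ^ 2 * ∑ i, ‖x i‖ ^ 2 := by
  have h := Matrix.l2_opNorm_mulVec A (WithLp.toLp 2 x)
  have h2 := pow_le_pow_left₀ (norm_nonneg _) h 2
  rw [mul_pow, EuclideanSpace.norm_sq_eq, EuclideanSpace.norm_sq_eq] at h2
  exact h2

lemma norm_kronecker_one_le (A : Matrix n n ℂ) : ‖A ⊗ₖ (1 : Matrix k k ℂ)‖ ≤ ‖A‖ := by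
  refine norm_le_of_sum_sq_le (norm_nonneg _) fun x => ?_
  have h (i : n) (a : k) :
      ((A ⊗ₖ (1 : Matrix k k ℂ)) *ᵥ x) (i, a) = (A *ᵥ fun j => x (j, a)) i := by
    simp [Matrix.mulVec, dotProduct, Fintype.sum_prod_type, Matrix.one_apply]
  simp only [Fintype.sum_prod_type_right, h, Finset.mul_sum]
  exact Finset.sum_le_sum fun a _ => by
    rw [← Finset.mul_sum]; exact sum_sq_mulVec_le A fun j => x (j, a)

/-- The part of a matrix on a product that is block diagonal with respect to the first factor. -/
def dephase (X : Matrix (n × k) (n × k) ℂ) : Matrix (n × k) (n × k) ℂ :=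
  fun p q => if p.1 = q.1 then X p q else 0

/-- Block `i` of `dephase M *ᵥ x` is block `i` of `M` applied to `x` truncated to that block, and
the squared norms of the truncations add up to that of `x`. -/
lemma norm_dephase_le (M : Matrix (n × k) (n × k) ℂ) : ‖dephase M‖ ≤ ‖M‖ := by
  refine norm_le_of_sum_sq_le (norm_nonneg _) fun x => ?_
  set y : n → n × k → ℂ := fun i q => if q.1 = i then x q else 0
  have h (i : n) (a : k) : (dephase M *ᵥ x) (i, a) = (M *ᵥ y i) (i, a) := by
    simp only [Matrix.mulVec, dotProduct, dephase, y]
    refine Finset.sum_congr rfl fun q _ => ?_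
    by_cases hq : i = q.1 <;> simp [hq, eq_comm]
  have h2 (i : n) : ∑ a, ‖(dephase M *ᵥ x) (i, a)‖ ^ 2 ≤ ‖M‖ ^ 2 * ∑ a, ‖x (i, a)‖ ^ 2 := by
    have h3 : ∑ q, ‖y i q‖ ^ 2 = ∑ a, ‖x (i, a)‖ ^ 2 := by
      rw [Fintype.sum_prod_type]
      rw [Finset.sum_eq_single i]
      · simp [y]
      · intro j _ hj; simp [y, hj]
      · simp
    rw [← h3]
    refine le_trans ?_ (sum_sq_mulVec_le M (y i))
    rw [Fintype.sum_prod_type]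
    simp only [h]
    exact Finset.single_le_sum (f := fun j => ∑ a, ‖(M *ᵥ y i) (j, a)‖ ^ 2)
      (fun j _ => Finset.sum_nonneg fun a _ => sq_nonneg _) (Finset.mem_univ i)
  rw [Fintype.sum_prod_type, Fintype.sum_prod_type, Finset.mul_sum]
  exact Finset.sum_le_sum fun i _ => h2 i

omit [DecidableEq k] in
lemma trace_mul_dephase (M X : Matrix (n × k) (n × k) ℂ) :
    (M * dephase X).trace = (dephase M * X).trace := by
  simp only [Matrix.trace, Matrix.diag_apply, Matrix.mul_apply, dephase]
  refine Finset.sum_congr rfl fun p _ => Finset.sum_congr rfl fun q _ => ?_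
  by_cases h : p.1 = q.1 <;> simp [h, eq_comm]

theorem traceNorm_dephase_le (X : Matrix (n × k) (n × k) ℂ) :
    traceNorm (dephase X) ≤ traceNorm X := by
  obtain ⟨M, hM, h⟩ := exists_trace_mul_eq_traceNorm (dephase X)
  rw [← Complex.ofReal_re (traceNorm (dephase X)), ← h, trace_mul_dephase]
  exact re_trace_mul_le_traceNorm ((norm_dephase_le M).trans hM) X

omit [Fintype n] [DecidableEq n] [Fintype k] [DecidableEq k] in
lemma ampliate_sub (S T : Matrix n n ℂ →ₗ[ℂ] Matrix n n ℂ) (X : Matrix (n × k) (n × k) ℂ) :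
    ampliate (S - T) X = ampliate S X - ampliate T X := rfl

omit [DecidableEq n] in
lemma ampliate_unitaryChannel (W : Matrix n n ℂ) (X : Matrix (n × k) (n × k) ℂ) :
    ampliate (unitaryChannel W) X =
      (W ⊗ₖ (1 : Matrix k k ℂ)) * X * (W ⊗ₖ (1 : Matrix k k ℂ))ᴴ := by
  ext p q
  simp [ampliate, unitaryChannel, Matrix.mul_apply, Fintype.sum_prod_type, Matrix.one_apply,
    apply_ite]
  rfl

lemma ampliate_unitaryChannel_one (X : Matrix (n × k) (n × k) ℂ) :
    ampliate (unitaryChannel 1) X = X := by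
  rw [ampliate_unitaryChannel]
  simp

lemma vonNeumannMeasurement_apply (V σ : Matrix n n ℂ) :
    vonNeumannMeasurement V σ = Matrix.diagonal fun i => (Vᴴ * σ * V) i i := by
  have h (i : n) : (columnProjector V i * σ).trace = (Vᴴ * σ * V) i i := by
    simp only [columnProjector, Matrix.trace, Matrix.diag_apply, Matrix.mul_apply,
      Matrix.vecMulVec_apply, Matrix.conjTranspose_apply, Finset.sum_mul]
    exact Finset.sum_congr rfl fun a _ => Finset.sum_congr rfl fun b _ => by ring
  ext a b
  change (∑ i, (columnProjector V i * σ).trace • Matrix.single i i (1 : ℂ)) a b = _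
  simp only [h, Matrix.sum_apply, Matrix.smul_apply, Matrix.single_apply, Matrix.diagonal_apply]
  by_cases hab : a = b
  · subst hab; simp
  · simp only [hab, if_false]
    exact Finset.sum_eq_zero fun i _ => by
      rw [if_neg (fun h => hab (h.1.symm.trans h.2)), smul_zero]

omit [Fintype k] [DecidableEq k] in
lemma ampliate_vonNeumannMeasurement (V : Matrix n n ℂ) (X : Matrix (n × k) (n × k) ℂ) :
    ampliate (vonNeumannMeasurement V) X = dephase (ampliate (unitaryChannel Vᴴ) X) := by
  ext p q
  have h := vonNeumannMeasurement_apply V (Matrix.of fun i j => X (i, p.2) (j, q.2))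
  have h' := congrFun (congrFun h p.1) q.1
  rw [Matrix.diagonal_apply] at h'
  refine h'.trans ?_
  by_cases hpq : p.1 = q.1
  · simp only [dephase, hpq, if_true, ampliate, unitaryChannel, Matrix.conjTranspose_conjTranspose]
    rfl
  · simp only [dephase, hpq, if_false]

lemma norm_diagonalUnitary_apply {F : Matrix n n ℂ} (hF : F ∈ diagonalUnitary n) (i : n) :
    star (F i i) * F i i = 1 := by
  have h : Fᴴ * F = 1 := Unitary.star_mul_self_of_mem hF.1
  have h1 := congrFun (congrFun h i) i
  rw [← hF.2.diagonal_diag, Matrix.diagonal_conjTranspose, Matrix.diagonal_mul_diagonal] at h1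
  simpa using h1

lemma vonNeumannMeasurement_mul_diagonalUnitary (V : Matrix n n ℂ) {F : Matrix n n ℂ}
    (hF : F ∈ diagonalUnitary n) :
    vonNeumannMeasurement (V * F) = vonNeumannMeasurement V := by
  ext1 σ
  rw [vonNeumannMeasurement_apply, vonNeumannMeasurement_apply]
  congr 1
  ext i
  have h : (V * F)ᴴ * σ * (V * F) = Fᴴ * (Vᴴ * σ * V) * F := by
    simp only [Matrix.conjTranspose_mul, mul_assoc]
  have hd : F = Matrix.diagonal F.diag := hF.2.diagonal_diag.symm
  rw [h, hd, Matrix.diagonal_conjTranspose, Matrix.mul_diagonal, Matrix.diagonal_mul]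
  have := norm_diagonalUnitary_apply hF i
  simp only [Matrix.diag_apply, Pi.star_apply]
  linear_combination (Vᴴ * σ * V) i i * this

lemma diamondNorm_nonneg (S : Matrix n n ℂ →ₗ[ℂ] Matrix k k ℂ) : 0 ≤ diamondNorm S :=
  Real.sSup_nonneg (by rintro _ ⟨X, _, rfl⟩; exact traceNorm_nonneg _)

lemma diamondNorm_le {S : Matrix n n ℂ →ₗ[ℂ] Matrix k k ℂ} {c : ℝ} (hc : 0 ≤ c)
    (h : ∀ X : Matrix (n × n) (n × n) ℂ, traceNorm X = 1 → traceNorm (ampliate S X) ≤ c) :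
    diamondNorm S ≤ c :=
  Real.sSup_le (by rintro _ ⟨X, hX, rfl⟩; exact h X hX) hc

/-- The a priori bound `c` serves only to make the set bounded above, so that its `sSup` is a
genuine supremum. -/
lemma traceNorm_ampliate_le_diamondNorm {S : Matrix n n ℂ →ₗ[ℂ] Matrix k k ℂ} (c : ℝ)
    (h : ∀ X : Matrix (n × n) (n × n) ℂ, traceNorm X = 1 → traceNorm (ampliate S X) ≤ c)
    {X : Matrix (n × n) (n × n) ℂ} (hX : traceNorm X = 1) :
    traceNorm (ampliate S X) ≤ diamondNorm S :=
  le_csSup ⟨c, by rintro _ ⟨Y, hY, rfl⟩; exact h Y hY⟩ ⟨X, hX, rfl⟩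

lemma traceNorm_ampliate_unitaryChannel_sub_le {W : Matrix n n ℂ}
    (hW : W ∈ Matrix.unitaryGroup n ℂ) (c : ℂ) (X : Matrix (n × k) (n × k) ℂ) :
    traceNorm (ampliate (unitaryChannel W - unitaryChannel 1) X) ≤
      2 * ‖W - c • 1‖ * traceNorm X := by
  rw [ampliate_sub, ampliate_unitaryChannel_one, ampliate_unitaryChannel]
  set K := W ⊗ₖ (1 : Matrix k k ℂ)
  have hWW : W * Wᴴ = 1 := Unitary.mul_star_self_of_mem hW
  have hK : K * Kᴴ = 1 := by
    simp [K, Matrix.conjTranspose_kronecker, ← Matrix.mul_kronecker_mul, hWW]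
  have hKK : Kᴴ * K = 1 := mul_eq_one_comm.1 hK
  have hKn : ‖Kᴴ‖ ≤ 1 := by
    apply norm_le_one_of_norm_mul_star_le
    rw [Matrix.conjTranspose_conjTranspose, hKK]
    exact norm_one_le
  set Y := K - c • 1
  have hY : ‖Y‖ ≤ ‖W - c • 1‖ := by
    have : Y = (W - c • 1) ⊗ₖ (1 : Matrix k k ℂ) := by
      rw [sub_eq_add_neg, ← neg_smul, Matrix.add_kronecker, Matrix.smul_kronecker,
        Matrix.one_kronecker_one, neg_smul, ← sub_eq_add_neg]
    rw [this]
    exact norm_kronecker_one_le _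
  -- The two terms containing `c` cancel, which leaves `c` free to be the centre of a disc around
  -- the spectrum.
  have h : K * X * Kᴴ - X = Y * X * Kᴴ + (-1) * X * (Y * Kᴴ) := by
    simp only [Y, sub_mul, mul_sub, neg_mul, one_mul, smul_mul_assoc, mul_smul_comm, hK, mul_one]
    rw [smul_neg]
    abel
  have hn1 : ‖(-1 : Matrix (n × k) (n × k) ℂ)‖ ≤ 1 := by rw [norm_neg]; exact norm_one_le
  have hYK : ‖Y * Kᴴ‖ ≤ ‖Y‖ :=
    (norm_mul_le _ _).trans (mul_le_of_le_one_right (norm_nonneg _) hKn)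
  have ht := traceNorm_nonneg X
  rw [h]
  calc _ ≤ traceNorm (Y * X * Kᴴ) + traceNorm ((-1) * X * (Y * Kᴴ)) := traceNorm_add_le _ _
    _ ≤ ‖Y‖ * ‖Kᴴ‖ * traceNorm X + ‖(-1 : Matrix (n × k) (n × k) ℂ)‖ * ‖Y * Kᴴ‖ * traceNorm X :=
        add_le_add (traceNorm_mul_mul_le _ _ _) (traceNorm_mul_mul_le _ _ _)
    _ ≤ ‖Y‖ * 1 * traceNorm X + 1 * ‖Y‖ * traceNorm X := by gcongr
    _ = 2 * ‖Y‖ * traceNorm X := by ring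
    _ ≤ _ := by gcongr

theorem diamondNorm_unitaryChannel_sub_le {W : Matrix n n ℂ}
    (hW : W ∈ Matrix.unitaryGroup n ℂ) (c : ℂ) :
    diamondNorm (unitaryChannel W - unitaryChannel 1) ≤ 2 * ‖W - c • 1‖ :=
  diamondNorm_le (by positivity) fun X hX => by
    simpa [hX] using traceNorm_ampliate_unitaryChannel_sub_le hW c X

lemma traceNorm_ampliate_unitaryChannel_sub_le_two {W : Matrix n n ℂ}
    (hW : W ∈ Matrix.unitaryGroup n ℂ) {X : Matrix (n × k) (n × k) ℂ} (hX : traceNorm X = 1) :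
    traceNorm (ampliate (unitaryChannel W - unitaryChannel 1) X) ≤ 2 := by
  refine (traceNorm_ampliate_unitaryChannel_sub_le hW 0 X).trans ?_
  rw [hX, zero_smul, sub_zero]
  linarith [norm_le_one_of_mem_unitaryGroup hW]

lemma traceNorm_ampliate_vonNeumannMeasurement_sub_le {W : Matrix n n ℂ}
    (hW : W ∈ Matrix.unitaryGroup n ℂ) (X : Matrix (n × k) (n × k) ℂ) :
    traceNorm (ampliate (vonNeumannMeasurement W - vonNeumannMeasurement 1) X) ≤
      traceNorm (ampliate (unitaryChannel W - unitaryChannel 1) X) := by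
  have hd : ampliate (vonNeumannMeasurement W - vonNeumannMeasurement 1) X =
      dephase (ampliate (unitaryChannel Wᴴ) X - X) := by
    rw [ampliate_sub, ampliate_vonNeumannMeasurement, ampliate_vonNeumannMeasurement,
      Matrix.conjTranspose_one, ampliate_unitaryChannel_one]
    ext p q
    by_cases h : p.1 = q.1 <;> simp [dephase, h]
  rw [hd]
  refine (traceNorm_dephase_le _).trans ?_
  rw [ampliate_sub, ampliate_unitaryChannel_one, ampliate_unitaryChannel, ampliate_unitaryChannel,
    Matrix.conjTranspose_kronecker, Matrix.conjTranspose_kronecker, Matrix.conjTranspose_one,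
    Matrix.conjTranspose_conjTranspose]
  set K := W ⊗ₖ (1 : Matrix k k ℂ) with hKd
  set L := Wᴴ ⊗ₖ (1 : Matrix k k ℂ) with hLd
  have hWW : Wᴴ * W = 1 := Unitary.star_mul_self_of_mem hW
  have hLK : L * K = 1 := by simp [K, L, ← Matrix.mul_kronecker_mul, hWW]
  have hL : ‖L‖ ≤ 1 :=
    (norm_kronecker_one_le _).trans (norm_le_one_of_mem_unitaryGroup (Unitary.star_mem hW))
  have hK : ‖K‖ ≤ 1 := (norm_kronecker_one_le _).trans (norm_le_one_of_mem_unitaryGroup hW)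
  -- With `L = Kᴴ`, conjugating by `K` exchanges the roles of the channel of `Wᴴ` and the channel of
  -- `W`.
  have h : L * X * K - X = (-L) * (K * X * L - X) * K := by
    have : L * (K * X * L) * K = X := by
      calc _ = (L * K) * X * (L * K) := by simp only [mul_assoc]
        _ = X := by rw [hLK, one_mul, mul_one]
    rw [neg_mul, neg_mul, mul_sub, sub_mul, this, neg_sub]
  rw [h]
  refine (traceNorm_mul_mul_le _ _ _).trans (mul_le_of_le_one_left (traceNorm_nonneg _) ?_)
  rw [norm_neg]
  exact mul_le_one₀ hL (norm_nonneg _) hK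

lemma traceNorm_ampliate_le_diamondNorm_vonNeumannMeasurement {W : Matrix n n ℂ}
    (hW : W ∈ Matrix.unitaryGroup n ℂ) {X : Matrix (n × n) (n × n) ℂ} (hX : traceNorm X = 1) :
    traceNorm (ampliate (vonNeumannMeasurement W - vonNeumannMeasurement 1) X) ≤
      diamondNorm (vonNeumannMeasurement W - vonNeumannMeasurement 1) :=
  traceNorm_ampliate_le_diamondNorm 2 (fun Y hY =>
    (traceNorm_ampliate_vonNeumannMeasurement_sub_le hW Y).trans
      (traceNorm_ampliate_unitaryChannel_sub_le_two hW hY)) hX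

theorem diamondNorm_vonNeumannMeasurement_sub_le {V F : Matrix n n ℂ}
    (hV : V ∈ Matrix.unitaryGroup n ℂ) (hF : F ∈ diagonalUnitary n) :
    diamondNorm (vonNeumannMeasurement V - vonNeumannMeasurement 1) ≤
      diamondNorm (unitaryChannel (V * F) - unitaryChannel 1) := by
  have hW : V * F ∈ Matrix.unitaryGroup n ℂ := mul_mem hV hF.1
  rw [← vonNeumannMeasurement_mul_diagonalUnitary V hF]
  exact diamondNorm_le (diamondNorm_nonneg _) fun X hX =>
    (traceNorm_ampliate_vonNeumannMeasurement_sub_le hW X).trans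
      (traceNorm_ampliate_le_diamondNorm 2
        (fun Y hY => traceNorm_ampliate_unitaryChannel_sub_le_two hW hY) hX)

end Upper

/-! ### Lower bounds from purified input states -/

section Lower

variable {n k : Type*} [Fintype n] [DecidableEq n] [Fintype k] [DecidableEq k]

open scoped MatrixOrder in
lemma exists_conjTranspose_mul_self_eq {A : Matrix n n ℂ} (hA : A.PosSemidef) :
    ∃ B : Matrix n n ℂ, A = Bᴴ * B :=
  CStarAlgebra.nonneg_iff_eq_star_mul_self.mp hA.nonneg

/-- Such an `M` is a sign operator with spectrum in `{-1, 0, 1}`; concretely `M² M² = M²` forces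
`‖M²‖² = ‖M²‖`. The two equations can be checked block by block, which suits dual witnesses for
block diagonal matrices. -/
lemma norm_le_one_of_cube_eq {M : Matrix n n ℂ} (hM : Mᴴ = M) (h : M * M * M = M) : ‖M‖ ≤ 1 := by
  apply norm_le_one_of_norm_mul_star_le
  apply norm_le_one_of_norm_mul_star_le
  have h1 := CStarRing.norm_self_mul_star (x := M)
  have h2 := CStarRing.norm_self_mul_star (x := M * M)
  simp only [Matrix.star_eq_conjTranspose, Matrix.conjTranspose_mul, hM] at h1 h2 ⊢
  rw [← mul_assoc, h] at h2 ⊢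
  rcases (norm_nonneg (M * M)).eq_or_lt with h0 | h0
  · rw [← h0]; exact zero_le_one
  · have : ‖M * M‖ * (‖M * M‖ - 1) = 0 := by linear_combination -h2
    rcases mul_eq_zero.1 this with h3 | h3 <;> linarith

/-- The block diagonal matrix on a product whose blocks are indexed by the first factor. -/
def blockMatrix (A : n → Matrix k k ℂ) : Matrix (n × k) (n × k) ℂ :=
  fun p q => if p.1 = q.1 then A p.1 p.2 q.2 else 0

omit [DecidableEq k] in
lemma blockMatrix_mul (A B : n → Matrix k k ℂ) :
    blockMatrix A * blockMatrix B = blockMatrix fun i => A i * B i := by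
  ext p q
  simp only [Matrix.mul_apply, blockMatrix, Fintype.sum_prod_type]
  rw [Finset.sum_eq_single p.1]
  · by_cases h : p.1 = q.1 <;> simp [h]
  · intro j _ hj
    simp [hj.symm]
  · simp

omit [Fintype n] [Fintype k] [DecidableEq k] in
lemma blockMatrix_conjTranspose (A : n → Matrix k k ℂ) :
    (blockMatrix A)ᴴ = blockMatrix fun i => (A i)ᴴ := by
  ext p q
  by_cases h : p.1 = q.1
  · simp [blockMatrix, h]
  · simp [blockMatrix, h, Ne.symm h]

omit [DecidableEq k] in
lemma trace_blockMatrix (A : n → Matrix k k ℂ) :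
    (blockMatrix A).trace = ∑ i, (A i).trace := by
  simp [Matrix.trace, blockMatrix, Fintype.sum_prod_type]

lemma sum_le_traceNorm_blockMatrix {A : n → Matrix k k ℂ} {r : n → ℝ}
    (h : ∀ i, ∃ M : Matrix k k ℂ, Mᴴ = M ∧ M * M * M = M ∧ (M * A i).trace = r i) :
    ∑ i, r i ≤ traceNorm (blockMatrix A) := by
  choose M hM hM3 htr using h
  have hn : ‖blockMatrix M‖ ≤ 1 := by
    apply norm_le_one_of_cube_eq
    · simp only [blockMatrix_conjTranspose, hM]
    · simp only [blockMatrix_mul, hM3]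
  have := re_trace_mul_le_traceNorm hn (blockMatrix A)
  rw [blockMatrix_mul, trace_blockMatrix] at this
  simpa [htr] using this

-- The difference `A` of the two rank-one matrices has nonzero eigenvalues `±sp` when `p ≠ 0`, hence
-- `A³ = s²p² A` and `A / (sp)` is its sign. If `p = 0`, the inverse is `0` and the witness is `0`.
omit [DecidableEq k] in
lemma exists_sign_of_norm_eq {a b : k → ℂ} {p s : ℝ} {m : ℂ} (ha : star a ⬝ᵥ a = p)
    (hb : star b ⬝ᵥ b = p) (hab : star a ⬝ᵥ b = m) (hs : s ≠ 0)
    (hm : star m * m = (1 - s ^ 2) * p ^ 2) :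
    ∃ M : Matrix k k ℂ, Mᴴ = M ∧ M * M * M = M ∧
      (M * (Matrix.vecMulVec a (star a) - Matrix.vecMulVec b (star b))).trace =
        ((2 * s * p : ℝ) : ℂ) := by
  have hba : star b ⬝ᵥ a = star m := by
    rw [← hab, ← Matrix.star_dotProduct_star, star_star, dotProduct_comm]
  set A := Matrix.vecMulVec a (star a) - Matrix.vecMulVec b (star b) with hA
  have hAA : A * A = (p : ℂ) • Matrix.vecMulVec a (star a) + (p : ℂ) • Matrix.vecMulVec b (star b)
      - m • Matrix.vecMulVec a (star b) - star m • Matrix.vecMulVec b (star a) := by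
    simp only [hA, sub_mul, mul_sub, Matrix.vecMulVec_mul_vecMulVec, ha, hb, hab, hba,
      Matrix.vecMulVec_smul]
    abel
  have hA3 : A * A * A = ((s : ℂ) ^ 2 * p ^ 2) • A := by
    have : (s : ℂ) ^ 2 * p ^ 2 = p ^ 2 - star m * m := by rw [hm]; ring
    rw [this, hAA]
    simp only [hA, sub_mul, mul_sub, add_mul, smul_mul_assoc, Matrix.vecMulVec_mul_vecMulVec, ha,
      hb, hab, hba, Matrix.vecMulVec_smul]
    module
  have htr : (A * A).trace = 2 * s ^ 2 * p ^ 2 := by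
    rw [hAA]
    simp only [Matrix.trace_add, Matrix.trace_sub, Matrix.trace_smul, Matrix.trace_vecMulVec,
      smul_eq_mul]
    rw [dotProduct_comm a, dotProduct_comm b, dotProduct_comm a, dotProduct_comm b, ha, hb, hab,
      hba]
    linear_combination -2 * hm
  have hAH : Aᴴ = A := by
    simp [hA, Matrix.conjTranspose_sub, Matrix.conjTranspose_vecMulVec]
  refine ⟨((s * p : ℝ) : ℂ)⁻¹ • A, ?_, ?_, ?_⟩
  · rw [Matrix.conjTranspose_smul, hAH]
    congr 1
    simp
  · simp only [smul_mul_assoc, mul_smul_comm, hA3, smul_smul]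
    congr 1
    push_cast
    by_cases hp : p = 0
    · simp [hp]
    · have : (s : ℂ) ≠ 0 := by exact_mod_cast hs
      have : (p : ℂ) ≠ 0 := by exact_mod_cast hp
      field_simp
  · rw [smul_mul_assoc, Matrix.trace_smul, htr]
    push_cast
    rw [smul_eq_mul]
    by_cases hp : p = 0
    · simp [hp]
    · have : (s : ℂ) ≠ 0 := by exact_mod_cast hs
      have : (p : ℂ) ≠ 0 := by exact_mod_cast hp
      field_simp

-- For orthogonal vectors the sign of the difference is the projection onto `a` minus the projection
-- onto `b`; zero vectors drop out through `0⁻¹ = 0`.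
omit [DecidableEq k] in
lemma exists_sign_of_orthogonal {a b : k → ℂ} {p q : ℝ} (ha : star a ⬝ᵥ a = p)
    (hb : star b ⬝ᵥ b = q) (hab : star a ⬝ᵥ b = 0) :
    ∃ M : Matrix k k ℂ, Mᴴ = M ∧ M * M * M = M ∧
      (M * (Matrix.vecMulVec a (star a) - Matrix.vecMulVec b (star b))).trace =
        ((p + q : ℝ) : ℂ) := by
  have hba : star b ⬝ᵥ a = 0 := by
    rw [← star_zero, ← hab, ← Matrix.star_dotProduct_star, star_star, dotProduct_comm]
  have hinv (x : ℂ) : x⁻¹ * (x⁻¹ * x) = x⁻¹ := by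
    by_cases hx : x = 0
    · simp [hx]
    · field_simp
  have hinv' (x : ℂ) : x⁻¹ * (x * x) = x := by
    by_cases hx : x = 0
    · simp [hx]
    · field_simp
  set P := Matrix.vecMulVec a (star a)
  set Q := Matrix.vecMulVec b (star b)
  have hPP : P * P = (p : ℂ) • P := by
    simp only [P, Matrix.vecMulVec_mul_vecMulVec, ha, Matrix.vecMulVec_smul]
  have hQQ : Q * Q = (q : ℂ) • Q := by
    simp only [Q, Matrix.vecMulVec_mul_vecMulVec, hb, Matrix.vecMulVec_smul]
  have hPQ : P * Q = 0 := by
    simp only [P, Q, Matrix.vecMulVec_mul_vecMulVec, hab, zero_smul, Matrix.vecMulVec_zero]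
  have hQP : Q * P = 0 := by
    simp only [P, Q, Matrix.vecMulVec_mul_vecMulVec, hba, zero_smul, Matrix.vecMulVec_zero]
  have hPt : P.trace = p := by rw [Matrix.trace_vecMulVec, dotProduct_comm, ha]
  have hQt : Q.trace = q := by rw [Matrix.trace_vecMulVec, dotProduct_comm, hb]
  refine ⟨(p : ℂ)⁻¹ • P - (q : ℂ)⁻¹ • Q, ?_, ?_, ?_⟩
  · simp [P, Q, Matrix.conjTranspose_sub, Matrix.conjTranspose_vecMulVec,
      Matrix.conjTranspose_smul]
  · have h2 : ((p : ℂ)⁻¹ • P - (q : ℂ)⁻¹ • Q) * ((p : ℂ)⁻¹ • P - (q : ℂ)⁻¹ • Q) =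
        (p : ℂ)⁻¹ • P + (q : ℂ)⁻¹ • Q := by
      simp only [sub_mul, mul_sub, smul_mul_assoc, mul_smul_comm, hPP, hQQ, hPQ, hQP, smul_zero,
        smul_sub, smul_smul, hinv]
      abel
    rw [h2]
    simp only [add_mul, mul_sub, smul_mul_assoc, mul_smul_comm, hPP, hQQ, hPQ, hQP, smul_zero,
      smul_add, smul_smul, hinv]
    abel
  · simp only [sub_mul, mul_sub, smul_mul_assoc, hPP, hQQ, hPQ, hQP, smul_zero, smul_smul,
      Matrix.trace_sub, Matrix.trace_smul, hPt, hQt, smul_eq_mul, mul_assoc, hinv',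
      Matrix.trace_zero]
    push_cast
    ring

/-- The input is a purification of `ρ = Bᴴ B`. Outcome `i` leaves the ancilla in the unnormalised
conjugate of the `i`-th column of `B W`, respectively of `B`, so the output difference is block
diagonal with blocks of rank at most two, and each block has its own dual witness. -/
lemma sum_le_diamondNorm_vonNeumannMeasurement {W B : Matrix n n ℂ}
    (hW : W ∈ Matrix.unitaryGroup n ℂ) (hB : (Bᴴ * B).trace = 1) {r : n → ℝ}
    (h : ∀ i, ∃ M : Matrix n n ℂ, Mᴴ = M ∧ M * M * M = M ∧
      (M * (Matrix.vecMulVec (fun a => star ((B * W) a i)) (star fun a => star ((B * W) a i)) -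
        Matrix.vecMulVec (fun a => star (B a i)) (star fun a => star (B a i)))).trace = r i) :
    ∑ i, r i ≤ diamondNorm (vonNeumannMeasurement W - vonNeumannMeasurement 1) := by
  set ψ : n × n → ℂ := fun p => star (B p.2 p.1) with hψ
  have hX : traceNorm (Matrix.vecMulVec ψ (star ψ)) = 1 := by
    rw [traceNorm_vecMulVec_star]
    apply Complex.ofReal_injective
    rw [norm_toLp_sq, Complex.ofReal_one, ← hB]
    simp only [dotProduct, Fintype.sum_prod_type, Matrix.trace, Matrix.diag_apply,
      Matrix.mul_apply, Matrix.conjTranspose_apply, hψ, Pi.star_apply, star_star]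
    exact Finset.sum_congr rfl fun _ _ => Finset.sum_congr rfl fun _ _ => mul_comm _ _
  have hV (V : Matrix n n ℂ) : ampliate (vonNeumannMeasurement V) (Matrix.vecMulVec ψ (star ψ)) =
      blockMatrix fun i => Matrix.vecMulVec (fun a => star ((B * V) a i))
        (star fun a => star ((B * V) a i)) := by
    rw [ampliate_vonNeumannMeasurement]
    ext p q
    by_cases hpq : p.1 = q.1
    · simp only [dephase, blockMatrix, hpq, if_true]
      simp only [ampliate, unitaryChannel, LinearMap.coe_mk, AddHom.coe_mk, Matrix.mul_apply,
        Matrix.conjTranspose_apply, Matrix.vecMulVec_apply, hψ, Pi.star_apply, star_star, star_sum,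
        star_mul', Finset.sum_mul, Finset.mul_sum]
      refine Finset.sum_congr rfl fun x _ => ?_
      change (∑ y, star (V y p.1) * (star (B p.2 y) * B q.2 x)) * _ = _
      rw [Finset.sum_mul, hpq]
      exact Finset.sum_congr rfl fun y _ => by ring
    · simp [dephase, blockMatrix, hpq]
  refine le_trans ?_ (traceNorm_ampliate_le_diamondNorm_vonNeumannMeasurement hW hX)
  rw [ampliate_sub, hV, hV, mul_one]
  have hs (A C : n → Matrix n n ℂ) :
      blockMatrix A - blockMatrix C = blockMatrix fun i => A i - C i := by
    ext p q
    by_cases hpq : p.1 = q.1 <;> simp [blockMatrix, hpq]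
  rw [hs]
  exact sum_le_traceNorm_blockMatrix h

omit [DecidableEq n] in
lemma star_dotProduct_star_col (A B : Matrix n n ℂ) (i : n) :
    (star fun a => star (A a i)) ⬝ᵥ (fun a => star (B a i)) = (Bᴴ * A) i i := by
  simp only [dotProduct, Matrix.mul_apply, Matrix.conjTranspose_apply, Pi.star_apply, star_star]
  exact Finset.sum_congr rfl fun _ _ => mul_comm _ _

omit [Fintype n] [DecidableEq n] in
lemma posSemidef_apply_eq_re {ρ : Matrix n n ℂ} (hρ : ρ.PosSemidef) (i : n) :
    ρ i i = ((ρ i i).re : ℂ) :=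
  (Complex.conj_eq_iff_re.1 (by simpa using hρ.1.apply i i)).symm

omit [DecidableEq n] in
lemma sum_re_diag_eq_one {ρ : Matrix n n ℂ} (htr : ρ.trace = 1) : ∑ i, (ρ i i).re = 1 := by
  simpa [Matrix.trace] using congrArg Complex.re htr

/-- For outcome `i` the two ancilla vectors have equal squared norm `ρ i i` and inner product `μ * ρ
i i`, so block `i` contributes `2 s (ρ i i)`. -/
theorem two_mul_le_diamondNorm_of_diag_eq {W ρ : Matrix n n ℂ} (hW : W ∈ Matrix.unitaryGroup n ℂ)
    (hρ : ρ.PosSemidef) (htr : ρ.trace = 1) {μ : ℂ} {s : ℝ} (hμ : star μ * μ = 1 - s ^ 2)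
    (h1 : ∀ i, (Wᴴ * ρ * W) i i = ρ i i) (h2 : ∀ i, (ρ * W) i i = μ * ρ i i) :
    2 * s ≤ diamondNorm (vonNeumannMeasurement W - vonNeumannMeasurement 1) := by
  by_cases hs : s = 0
  · rw [hs, mul_zero]; exact diamondNorm_nonneg _
  have hsum : ∑ i, 2 * s * (ρ i i).re = 2 * s := by
    rw [← Finset.mul_sum, sum_re_diag_eq_one htr, mul_one]
  have hre := posSemidef_apply_eq_re hρ
  obtain ⟨B, hB⟩ := exists_conjTranspose_mul_self_eq hρ
  rw [← hsum]
  refine sum_le_diamondNorm_vonNeumannMeasurement (B := B) hW (hB ▸ htr) fun i =>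
    exists_sign_of_norm_eq (m := μ * ρ i i) ?_ ?_ ?_ hs ?_
  · rw [star_dotProduct_star_col, Matrix.conjTranspose_mul, ← hre, ← h1, hB]
    simp only [mul_assoc]
  · rw [star_dotProduct_star_col, ← hre, hB]
  · rw [star_dotProduct_star_col, ← h2, hB, mul_assoc]
  · rw [star_mul']
    have : star (ρ i i) = ρ i i := hρ.1.apply i i
    rw [this, ← hre]
    linear_combination (ρ i i) ^ 2 * hμ

theorem two_le_diamondNorm_of_diag_eq_zero {W ρ : Matrix n n ℂ}
    (hW : W ∈ Matrix.unitaryGroup n ℂ) (hρ : ρ.PosSemidef) (htr : ρ.trace = 1)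
    (h : ∀ i, (ρ * W) i i = 0) :
    2 ≤ diamondNorm (vonNeumannMeasurement W - vonNeumannMeasurement 1) := by
  have hρW : (Wᴴ * ρ * W).PosSemidef := hρ.conjTranspose_mul_mul_same W
  have htr' : (Wᴴ * ρ * W).trace = 1 := by
    have : W * Wᴴ = 1 := Unitary.mul_star_self_of_mem hW
    rw [Matrix.trace_mul_cycle, this, one_mul, htr]
  have hsum : ∑ i, (((Wᴴ * ρ * W) i i).re + (ρ i i).re) = 2 := by
    rw [Finset.sum_add_distrib, sum_re_diag_eq_one htr, sum_re_diag_eq_one htr']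
    norm_num
  have hre := posSemidef_apply_eq_re hρ
  have hre' := posSemidef_apply_eq_re hρW
  obtain ⟨B, hB⟩ := exists_conjTranspose_mul_self_eq hρ
  rw [← hsum]
  refine sum_le_diamondNorm_vonNeumannMeasurement (B := B) hW (hB ▸ htr) fun i =>
    exists_sign_of_orthogonal ?_ ?_ ?_
  · rw [star_dotProduct_star_col, Matrix.conjTranspose_mul, ← hre', hB]
    simp only [mul_assoc]
  · rw [star_dotProduct_star_col, ← hre, hB]
  · rw [star_dotProduct_star_col, ← h i, hB, mul_assoc]

end Lower

/-! ### The optimal diagonal unitary by a minimax argument -/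

section Optimal

variable {n : Type*} [Fintype n] [DecidableEq n]

/-- Cayley transform: without eigenvalue `-1`, the matrix `i (1 - W) (1 + W)⁻¹` is Hermitian, and an
eigenbasis of it also diagonalises `W`. -/
theorem exists_unitary_diagonalization {W : Matrix n n ℂ} (hW : W ∈ Matrix.unitaryGroup n ℂ)
    (h : ∀ x : n → ℂ, W *ᵥ x = -x → x = 0) :
    ∃ Q ∈ Matrix.unitaryGroup n ℂ, ∃ w : n → ℂ, W = Q * Matrix.diagonal w * Qᴴ := by
  have hWW : Wᴴ * W = 1 := Unitary.star_mul_self_of_mem hW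
  have hdet : IsUnit (1 + W).det := by
    rw [isUnit_iff_ne_zero]
    intro h0
    obtain ⟨x, hx, hx0⟩ := Matrix.exists_mulVec_eq_zero_iff.2 h0
    rw [Matrix.add_mulVec, Matrix.one_mulVec] at hx0
    exact hx (h x (eq_neg_of_add_eq_zero_right hx0))
  set C := (1 + W)⁻¹
  have hC : C * (1 + W) = 1 := Matrix.nonsing_inv_mul _ hdet
  have hC' : Cᴴ * (1 + W)ᴴ = 1 := by
    rw [← Matrix.conjTranspose_mul, mul_eq_one_comm.1 hC, Matrix.conjTranspose_one]
  have hH : (Complex.I • (Wᴴ - W)).IsHermitian := by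
    rw [Matrix.IsHermitian, Matrix.conjTranspose_smul, Matrix.conjTranspose_sub,
      Matrix.conjTranspose_conjTranspose, Complex.star_def, Complex.conj_I, neg_smul, ← smul_neg,
      neg_sub]
  have hA := Matrix.isHermitian_conjTranspose_mul_mul C hH
  have hAW : Cᴴ * (Complex.I • (Wᴴ - W)) * C * (1 + W) = Complex.I • (1 - W) := by
    have : Complex.I • (Wᴴ - W) = (1 + W)ᴴ * (Complex.I • (1 - W)) := by
      rw [Matrix.conjTranspose_add, Matrix.conjTranspose_one, mul_smul_comm, add_mul, mul_sub,
        mul_sub, hWW]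
      simp
    rw [mul_assoc, hC, mul_one, this, ← mul_assoc, hC', one_mul]
  generalize Cᴴ * (Complex.I • (Wᴴ - W)) * C = A at hA hAW
  obtain ⟨Q, hQ, a, hs⟩ : ∃ Q ∈ Matrix.unitaryGroup n ℂ, ∃ a : n → ℝ,
      A = Q * Matrix.diagonal (fun i => (a i : ℂ)) * Qᴴ :=
    ⟨hA.eigenvectorUnitary, hA.eigenvectorUnitary.2, hA.eigenvalues, hA.spectral_theorem⟩
  have hQQ : Qᴴ * Q = 1 := Unitary.star_mul_self_of_mem hQ
  have hQQ' : Q * Qᴴ = 1 := Unitary.mul_star_self_of_mem hQ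
  have hrel : Matrix.diagonal (fun i => (a i : ℂ)) * (1 + Qᴴ * W * Q) =
      Complex.I • (1 - Qᴴ * W * Q) := by
    have h1 : Qᴴ * (A * (1 + W)) * Q = Qᴴ * (Complex.I • (1 - W)) * Q := by rw [hAW]
    have h2 : Qᴴ * (A * (1 + W)) * Q =
        Matrix.diagonal (fun i => (a i : ℂ)) * (1 + Qᴴ * W * Q) := by
      rw [hs]
      generalize Matrix.diagonal (fun i => (a i : ℂ)) = D
      calc Qᴴ * (Q * D * Qᴴ * (1 + W)) * Q = (Qᴴ * Q) * D * (Qᴴ * (1 + W) * Q) := by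
            simp only [mul_assoc]
        _ = D * (1 + Qᴴ * W * Q) := by rw [hQQ, one_mul, mul_add, add_mul, mul_one, hQQ]
    have h3 : Qᴴ * (Complex.I • (1 - W)) * Q = Complex.I • (1 - Qᴴ * W * Q) := by
      rw [mul_smul_comm, smul_mul_assoc, mul_sub, sub_mul, mul_one, hQQ]
    rw [← h2, h1, h3]
  refine ⟨Q, hQ, (Qᴴ * W * Q).diag, ?_⟩
  have hd : Matrix.diagonal (Qᴴ * W * Q).diag = Qᴴ * W * Q := by
    rw [← Matrix.isDiag_iff_diagonal_diag]
    intro i j hij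
    have := congrFun (congrFun hrel i) j
    rw [Matrix.diagonal_mul, Matrix.smul_apply, Matrix.add_apply, Matrix.sub_apply,
      Matrix.one_apply_ne hij, smul_eq_mul] at this
    -- Since `a i` is real, `a i + I` cannot vanish, so the off-diagonal entry must.
    have h0 : ((a i : ℂ) + Complex.I) * (Qᴴ * W * Q) i j = 0 := by
      linear_combination this
    refine (mul_eq_zero.1 h0).resolve_left fun h1 => ?_
    simpa using congrArg Complex.im h1
  rw [hd]
  calc W = (Q * Qᴴ) * W * (Q * Qᴴ) := by rw [hQQ', one_mul, mul_one]
    _ = _ := by simp only [mul_assoc]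

/-- Test the quadratic form at `y = D⁻¹ x`: its value is `c` times `S = ∑ (D i)⁻¹ ‖x i‖²`, while
`‖y‖² ≥ S` because `D ≤ 1`. This allows the moduli of the separating contraction to be discarded,
keeping only its phases. -/
lemma le_re_of_mulVec_eq_smul {W : Matrix n n ℂ} {D : n → ℝ} {ν : ℝ} (hν : 0 < ν)
    (hD : ∀ i, 0 < D i) (hD1 : ∀ i, D i ≤ 1)
    (h : ∀ x : n → ℂ, ν * ∑ i, ‖x i‖ ^ 2 ≤
      (star x ⬝ᵥ (W * Matrix.diagonal fun i => (D i : ℂ)) *ᵥ x).re)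
    {x : n → ℂ} (hx : x ≠ 0) {c : ℂ} (hc : W *ᵥ x = c • x) : ν ≤ c.re := by
  set y : n → ℂ := fun i => (((D i)⁻¹ : ℝ) : ℂ) * x i with hy
  have hDy : (Matrix.diagonal fun i => (D i : ℂ)) *ᵥ y = x := by
    ext i
    rw [Matrix.mulVec_diagonal, hy]
    have : (D i : ℂ) ≠ 0 := by exact_mod_cast (hD i).ne'
    push_cast
    field_simp
  have h1 := h y
  rw [← Matrix.mulVec_mulVec, hDy, hc, dotProduct_smul, smul_eq_mul] at h1
  have h2 : star y ⬝ᵥ x = ((∑ i, (D i)⁻¹ * ‖x i‖ ^ 2 : ℝ) : ℂ) := by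
    rw [dotProduct]
    push_cast
    refine Finset.sum_congr rfl fun i _ => ?_
    simp only [hy, Pi.star_apply, star_mul', Complex.star_def, Complex.conj_ofReal]
    rw [mul_assoc, Complex.conj_mul']
    push_cast
    rfl
  rw [h2, Complex.re_mul_ofReal] at h1
  set S := ∑ i, (D i)⁻¹ * ‖x i‖ ^ 2
  have hS : S ≤ ∑ i, ‖y i‖ ^ 2 := by
    refine Finset.sum_le_sum fun i _ => ?_
    have hi : 1 ≤ (D i)⁻¹ := (one_le_inv₀ (hD i)).2 (hD1 i)
    rw [hy, norm_mul, Complex.norm_real, Real.norm_of_nonneg (by positivity), mul_pow]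
    gcongr
    nlinarith
  have hSpos : 0 < S := by
    obtain ⟨i, hi⟩ := Function.ne_iff.1 hx
    refine Finset.sum_pos' (fun j _ => mul_nonneg (inv_nonneg.2 (hD j).le) (sq_nonneg _))
      ⟨i, Finset.mem_univ i, mul_pos (inv_pos.2 (hD i)) ?_⟩
    have := norm_pos_iff.2 hi
    positivity
  have h3 : ν * S ≤ c.re * S := (mul_le_mul_of_nonneg_left hS hν.le).trans h1
  exact le_of_mul_le_mul_right h3 hSpos

/-- The density matrices. -/
def densityMatrices (n : Type*) [Fintype n] : Set (Matrix n n ℂ) :=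
  {ρ | ρ.PosSemidef ∧ ρ.trace = 1}

lemma exists_density_minimizer [Nonempty n] (U : Matrix n n ℂ) :
    ∃ ρ ∈ densityMatrices n, ∀ σ ∈ densityMatrices n,
      ∑ i, ‖(ρ * U) i i‖ ≤ ∑ i, ‖(σ * U) i i‖ := by
  -- States are written as `Bᴴ B` with `B` on the Frobenius unit sphere, which is compact.
  set K : Set (n → n → ℂ) := {B | ∑ i, ∑ j, ‖B i j‖ ^ 2 = 1}
  set f : (n → n → ℂ) → ℝ :=
    fun B => ∑ i, ‖∑ j, (∑ a, star (B a i) * B a j) * U j i‖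
  have hK (B : n → n → ℂ) : B ∈ K ↔ ((Matrix.of B)ᴴ * Matrix.of B).trace = 1 := by
    have : ((Matrix.of B)ᴴ * Matrix.of B).trace = ((∑ i, ∑ j, ‖B i j‖ ^ 2 : ℝ) : ℂ) := by
      rw [Finset.sum_comm]
      simp only [Matrix.trace, Matrix.diag_apply, Matrix.mul_apply, Matrix.conjTranspose_apply,
        Matrix.of_apply, Complex.star_def, Complex.conj_mul']
      push_cast
      rfl
    rw [this, Complex.ofReal_eq_one]
    rfl
  have hcl : IsClosed K := isClosed_eq (by fun_prop) continuous_const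
  have hbd : Bornology.IsBounded K := by
    refine (Metric.isBounded_closedBall (x := (0 : n → n → ℂ)) (r := 1)).subset fun B hB => ?_
    rw [mem_closedBall_zero_iff, pi_norm_le_iff_of_nonneg zero_le_one]
    intro i
    rw [pi_norm_le_iff_of_nonneg zero_le_one]
    intro j
    rw [← sq_le_one_iff₀ (norm_nonneg _)]
    have hB' : ∑ i, ∑ j, ‖B i j‖ ^ 2 = 1 := hB
    rw [← hB']
    exact (Finset.single_le_sum (f := fun j => ‖B i j‖ ^ 2) (fun _ _ => sq_nonneg _)
      (Finset.mem_univ j)).trans (Finset.single_le_sum (f := fun i => ∑ j, ‖B i j‖ ^ 2)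
        (fun _ _ => Finset.sum_nonneg fun _ _ => sq_nonneg _) (Finset.mem_univ i))
  have hne : K.Nonempty := by
    obtain ⟨i₀⟩ := ‹Nonempty n›
    refine ⟨Matrix.single i₀ i₀ 1, (hK _).2 ?_⟩
    change ((Matrix.single i₀ i₀ (1 : ℂ))ᴴ * Matrix.single i₀ i₀ 1).trace = 1
    simp [Matrix.conjTranspose_single]
  have hcont : Continuous f := by fun_prop
  obtain ⟨B, hB, hmin⟩ :=
    (Metric.isCompact_of_isClosed_isBounded hcl hbd).exists_isMinOn hne hcont.continuousOn
  refine ⟨(Matrix.of B)ᴴ * Matrix.of B,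
    ⟨Matrix.posSemidef_conjTranspose_mul_self _, (hK B).1 hB⟩, fun σ hσ => ?_⟩
  obtain ⟨C, rfl⟩ := exists_conjTranspose_mul_self_eq hσ.1
  exact hmin ((hK C).2 hσ.2)

/-- Hahn–Banach separates the open ℓ¹ ball of radius `ν` from the convex set of diagonals of `σ U`.
Bounding the functional on the ball gives an ℓ^∞ bound on its coefficients. -/
lemma exists_diagonal_contraction {U : Matrix n n ℂ} {ν : ℝ} (hν : 0 < ν)
    (h : ∀ σ ∈ densityMatrices n, ν ≤ ∑ i, ‖(σ * U) i i‖) :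
    ∃ e : n → ℂ, (∀ i, ‖e i‖ ≤ 1) ∧
      ∀ σ ∈ densityMatrices n, ν ≤ (∑ i, (σ * U) i i * e i).re := by
  by_cases hne : (densityMatrices n).Nonempty
  swap
  · exact ⟨0, by simp, fun σ hσ => (hne ⟨σ, hσ⟩).elim⟩
  set s : Set (n → ℂ) := {x | ∑ i, ‖x i‖ < ν}
  set t : Set (n → ℂ) := (fun σ : Matrix n n ℂ => fun i => (σ * U) i i) '' densityMatrices n
  have hs : Convex ℝ s := by
    intro x hx y hy a b ha hb hab
    have hx' : ∑ i, ‖x i‖ < ν := hx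
    have hy' : ∑ i, ‖y i‖ < ν := hy
    change ∑ i, ‖(a • x + b • y) i‖ < ν
    calc ∑ i, ‖(a • x + b • y) i‖ ≤ ∑ i, (a * ‖x i‖ + b * ‖y i‖) := by
          refine Finset.sum_le_sum fun i _ => ?_
          refine (norm_add_le _ _).trans (le_of_eq ?_)
          simp [abs_of_nonneg ha, abs_of_nonneg hb]
      _ = a * ∑ i, ‖x i‖ + b * ∑ i, ‖y i‖ := by
          rw [Finset.sum_add_distrib, Finset.mul_sum, Finset.mul_sum]
      _ < ν := by
          rcases ha.eq_or_lt with rfl | ha'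
          · have : b = 1 := by linarith
            subst this; linarith
          · nlinarith
  have hso : IsOpen s := isOpen_lt (by fun_prop) continuous_const
  have ht : Convex ℝ t := by
    rintro _ ⟨σ, hσ, rfl⟩ _ ⟨τ, hτ, rfl⟩ a b ha hb hab
    refine ⟨(a : ℂ) • σ + (b : ℂ) • τ, ⟨?_, ?_⟩, ?_⟩
    · exact (hσ.1.smul (by exact_mod_cast ha)).add (hτ.1.smul (by exact_mod_cast hb))
    · rw [Matrix.trace_add, Matrix.trace_smul, Matrix.trace_smul, hσ.2, hτ.2]
      simp only [smul_eq_mul, mul_one]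
      exact_mod_cast hab
    · ext i
      simp [add_mul]
  have hdisj : Disjoint s t := by
    rw [Set.disjoint_left]
    rintro _ hx ⟨σ, hσ, rfl⟩
    exact absurd (h σ hσ) (not_le.2 hx)
  obtain ⟨f, u, hfs, hft⟩ := RCLike.geometric_hahn_banach_open (𝕜 := ℂ) hs hso ht hdisj
  have hu : 0 < u := by simpa using hfs 0 (by simpa [s] using hν)
  set e : n → ℂ := fun i => f (fun j => if i = j then 1 else 0)
  have hfx (x : n → ℂ) : f x = ∑ i, x i * e i :=
    LinearMap.pi_apply_eq_sum_univ (f : (n → ℂ) →ₗ[ℂ] ℂ) x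
  have hbound (i : n) : ν * ‖e i‖ ≤ u := by
    by_contra! hlt
    have hpos : 0 < ‖e i‖ := by
      by_contra! h0
      nlinarith
    have hc : (‖e i‖ : ℂ) ≠ 0 := by exact_mod_cast hpos.ne'
    -- The phase and modulus of `c` are chosen so that `c * e i = u`; a coefficient that is too
    -- large would put `c` inside the ball, against the strict separation.
    set c : ℂ := (u / ‖e i‖ : ℝ) * (star (e i) / ‖e i‖) with hcd
    have hcn : ‖c‖ < ν := by
      rw [hcd, norm_mul, Complex.norm_real, norm_div, norm_div (star (e i)),
        norm_star, Complex.norm_real, norm_norm, div_self hpos.ne', mul_one,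
        Real.norm_of_nonneg (by positivity), div_lt_iff₀ hpos]
      exact hlt
    have hmem : (Pi.single i c : n → ℂ) ∈ s := by
      change ∑ j, ‖(Pi.single i c : n → ℂ) j‖ < ν
      rw [Finset.sum_eq_single i]
      · simpa using hcn
      · intro j _ hj; simp [hj]
      · simp
    have hlt' := hfs _ hmem
    rw [hfx, Finset.sum_eq_single i (by intro j _ hj; simp [hj]) (by simp), Pi.single_eq_same]
      at hlt'
    have : c * e i = (u : ℂ) := by
      have h2 : star (e i) * e i = (‖e i‖ : ℂ) ^ 2 := Complex.conj_mul' _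
      rw [hcd]
      push_cast
      field_simp
      linear_combination h2
    rw [this] at hlt'
    simp at hlt'
  refine ⟨fun i => ((ν / u : ℝ) : ℂ) * e i, fun i => ?_, fun σ hσ => ?_⟩
  · rw [norm_mul, Complex.norm_real, Real.norm_of_nonneg (by positivity), div_mul_eq_mul_div,
      div_le_one hu]
    exact hbound i
  · have h1 : u ≤ (f fun i => (σ * U) i i).re := hft _ ⟨σ, hσ, rfl⟩
    have h2 : ∑ i, (σ * U) i i * (((ν / u : ℝ) : ℂ) * e i) =
        ((ν / u : ℝ) : ℂ) * f fun i => (σ * U) i i := by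
      rw [hfx, Finset.mul_sum]
      exact Finset.sum_congr rfl fun i _ => by ring
    rw [h2, Complex.re_ofReal_mul]
    calc ν = ν / u * u := by field_simp
      _ ≤ _ := by gcongr

/-- With `ρ = Bᴴ B` and `H = Cᴴ C` the trace is the squared Frobenius norm of `B Cᴴ`. The equality
case is the complementary slackness used for the extremal states. -/
lemma trace_mul_nonneg_and_eq_zero {ρ H : Matrix n n ℂ} (hρ : ρ.PosSemidef) (hH : H.PosSemidef) :
    0 ≤ (ρ * H).trace ∧ ((ρ * H).trace = 0 → ρ * H = 0) := by
  obtain ⟨B, rfl⟩ := exists_conjTranspose_mul_self_eq hρ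
  obtain ⟨C, rfl⟩ := exists_conjTranspose_mul_self_eq hH
  have h : (Bᴴ * B * (Cᴴ * C)).trace = ((B * Cᴴ)ᴴ * (B * Cᴴ)).trace := by
    rw [← mul_assoc, Matrix.trace_mul_comm, Matrix.conjTranspose_mul,
      Matrix.conjTranspose_conjTranspose]
    simp only [mul_assoc]
  rw [h]
  refine ⟨(Matrix.posSemidef_conjTranspose_mul_self _).trace_nonneg, fun h0 => ?_⟩
  have h1 : B * Cᴴ = 0 := Matrix.trace_conjTranspose_mul_self_eq_zero_iff.1 h0
  calc _ = Bᴴ * (B * Cᴴ) * C := by simp only [mul_assoc]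
    _ = 0 := by rw [h1, mul_zero, zero_mul]

lemma mem_unitaryGroup_of_diagonal {v : n → ℂ} (hv : ∀ i, ‖v i‖ = 1) :
    Matrix.diagonal v ∈ Matrix.unitaryGroup n ℂ := by
  rw [Matrix.mem_unitaryGroup_iff, Matrix.star_eq_conjTranspose, Matrix.diagonal_conjTranspose,
    Matrix.diagonal_mul_diagonal, ← Matrix.diagonal_one]
  congr 1
  ext i
  have := Complex.mul_conj' (v i)
  rw [hv] at this
  simpa using this

lemma diagonal_mem_diagonalUnitary {v : n → ℂ} (hv : ∀ i, ‖v i‖ = 1) :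
    Matrix.diagonal v ∈ diagonalUnitary n :=
  ⟨mem_unitaryGroup_of_diagonal hv, Matrix.isDiag_diagonal v⟩

lemma norm_eq_one_of_conj_diagonal {W Q : Matrix n n ℂ} {w : n → ℂ}
    (hW : W ∈ Matrix.unitaryGroup n ℂ) (hQ : Q ∈ Matrix.unitaryGroup n ℂ)
    (h : W = Q * Matrix.diagonal w * Qᴴ) (i : n) : ‖w i‖ = 1 := by
  have hQQ : Qᴴ * Q = 1 := Unitary.star_mul_self_of_mem hQ
  have hd : Matrix.diagonal w = Qᴴ * W * Q := by
    calc Matrix.diagonal w = (Qᴴ * Q) * Matrix.diagonal w * (Qᴴ * Q) := by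
          rw [hQQ, one_mul, mul_one]
      _ = _ := by rw [h]; simp only [mul_assoc]
  have hu : Matrix.diagonal w ∈ Matrix.unitaryGroup n ℂ := by
    rw [hd]
    exact mul_mem (mul_mem (Unitary.star_mem hQ) hW) hQ
  have h2 := norm_diagonalUnitary_apply ⟨hu, Matrix.isDiag_diagonal w⟩ i
  rw [Matrix.diagonal_apply_eq, Complex.star_def, Complex.conj_mul'] at h2
  have h3 : ‖w i‖ ^ 2 = 1 := by exact_mod_cast h2
  exact (pow_eq_one_iff_of_nonneg (norm_nonneg _) two_ne_zero).1 h3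

lemma mulVec_column_of_conj_diagonal {W Q : Matrix n n ℂ} {w : n → ℂ}
    (hQ : Q ∈ Matrix.unitaryGroup n ℂ) (h : W = Q * Matrix.diagonal w * Qᴴ) (i : n) :
    W *ᵥ (fun a => Q a i) = w i • fun a => Q a i := by
  have hQQ : Qᴴ * Q = 1 := Unitary.star_mul_self_of_mem hQ
  have h1 : W * Q = Q * Matrix.diagonal w := by
    rw [h, mul_assoc, hQQ, mul_one]
  ext a
  have := congrFun (congrFun h1 a) i
  rw [Matrix.mul_diagonal] at this
  rw [Pi.smul_apply, smul_eq_mul, mul_comm, ← this]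
  rfl

lemma column_ne_zero {Q : Matrix n n ℂ} (hQ : Q ∈ Matrix.unitaryGroup n ℂ) (i : n) :
    (fun a => Q a i) ≠ 0 := by
  intro h0
  have hQQ : Qᴴ * Q = 1 := Unitary.star_mul_self_of_mem hQ
  have h1 := congrFun (congrFun hQQ i) i
  rw [Matrix.mul_apply] at h1
  simp [fun a => congrFun h0 a] at h1

lemma posSemidef_re_sub {W Q : Matrix n n ℂ} {w : n → ℂ} {ν : ℝ}
    (hQ : Q ∈ Matrix.unitaryGroup n ℂ) (h : W = Q * Matrix.diagonal w * Qᴴ)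
    (hw : ∀ i, ν ≤ (w i).re) : (W + Wᴴ - ((2 * ν : ℝ) : ℂ) • 1).PosSemidef := by
  have hQQ : Q * Qᴴ = 1 := Unitary.mul_star_self_of_mem hQ
  have h1 : W + Wᴴ - ((2 * ν : ℝ) : ℂ) • 1 =
      Q * Matrix.diagonal (fun i => ((2 * ((w i).re - ν) : ℝ) : ℂ)) * Qᴴ := by
    have h2 : (fun i => ((2 * ((w i).re - ν) : ℝ) : ℂ)) =
        w + star w - fun _ => ((2 * ν : ℝ) : ℂ) := by
      ext i
      have := Complex.add_conj (w i)
      simp only [Pi.sub_apply, Pi.add_apply, Pi.star_apply, Complex.star_def, this]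
      push_cast
      ring
    have h3 : Matrix.diagonal (w + star w - fun _ => ((2 * ν : ℝ) : ℂ)) =
        Matrix.diagonal w + (Matrix.diagonal w)ᴴ - ((2 * ν : ℝ) : ℂ) • 1 := by
      rw [Matrix.diagonal_conjTranspose, Matrix.diagonal_add, Matrix.smul_one_eq_diagonal,
        Matrix.diagonal_sub]
      rfl
    rw [h2, h3, mul_sub, mul_add, sub_mul, add_mul, mul_smul_comm, mul_one, smul_mul_assoc, hQQ, h]
    simp only [Matrix.conjTranspose_mul, Matrix.conjTranspose_conjTranspose, mul_assoc]
  rw [h1]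
  refine Matrix.PosSemidef.mul_mul_conjTranspose_same (Matrix.PosSemidef.diagonal fun i => ?_) Q
  have : 0 ≤ 2 * ((w i).re - ν) := by linarith [hw i]
  exact Complex.zero_le_real.2 this

omit [DecidableEq n] in
lemma vecMulVec_mem_densityMatrices {x : n → ℂ} (hx : ∑ i, ‖x i‖ ^ 2 = 1) :
    Matrix.vecMulVec x (star x) ∈ densityMatrices n := by
  refine ⟨Matrix.posSemidef_vecMulVec_self_star x, ?_⟩
  rw [Matrix.trace_vecMulVec, dotProduct]
  simp only [Pi.star_apply, Complex.star_def, Complex.mul_conj']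
  exact_mod_cast hx

lemma sum_diag_mul_eq_trace (A : Matrix n n ℂ) (e : n → ℂ) :
    ∑ i, A i i * e i = (A * Matrix.diagonal e).trace := by
  simp [Matrix.trace]

omit [DecidableEq n] in
lemma mul_sum_sq_le_of_density {A : Matrix n n ℂ} {ν : ℝ}
    (h : ∀ σ ∈ densityMatrices n, ν ≤ (σ * A).trace.re) (x : n → ℂ) :
    ν * ∑ i, ‖x i‖ ^ 2 ≤ (star x ⬝ᵥ A *ᵥ x).re := by
  set S := ∑ i, ‖x i‖ ^ 2 with hS
  have hS0 : 0 ≤ S := Finset.sum_nonneg fun _ _ => sq_nonneg _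
  rcases hS0.eq_or_lt with h0 | h0
  · have hx : x = 0 := by
      ext i
      have := (Finset.sum_eq_zero_iff_of_nonneg (fun i _ => sq_nonneg ‖x i‖)).1 h0.symm i
        (Finset.mem_univ i)
      simpa using this
    rw [← h0, hx]
    simp
  · set c : ℝ := (Real.sqrt S)⁻¹
    have hc : c ^ 2 * S = 1 := by
      rw [inv_pow, Real.sq_sqrt hS0, inv_mul_cancel₀ h0.ne']
    have hx1 : ∑ i, ‖((c : ℂ) • x) i‖ ^ 2 = 1 := by
      rw [← hc, hS, Finset.mul_sum]
      refine Finset.sum_congr rfl fun i _ => ?_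
      rw [Pi.smul_apply, norm_smul, mul_pow, Complex.norm_real, Real.norm_eq_abs, sq_abs]
    have h1 := h _ (vecMulVec_mem_densityMatrices hx1)
    have h2 : (Matrix.vecMulVec ((c : ℂ) • x) (star ((c : ℂ) • x)) * A).trace =
        ((c ^ 2 : ℝ) : ℂ) * (star x ⬝ᵥ A *ᵥ x) := by
      rw [Matrix.trace_mul_comm, Matrix.mul_vecMulVec, Matrix.trace_vecMulVec, dotProduct_comm,
        star_smul, Matrix.mulVec_smul, smul_dotProduct, dotProduct_smul]
      simp only [Complex.star_def, Complex.conj_ofReal, smul_eq_mul]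
      push_cast
      ring
    rw [h2, Complex.re_ofReal_mul] at h1
    calc ν * S ≤ c ^ 2 * (star x ⬝ᵥ A *ᵥ x).re * S := by gcongr
      _ = (c ^ 2 * S) * (star x ⬝ᵥ A *ᵥ x).re := by ring
      _ = _ := by rw [hc, one_mul]

theorem exists_optimal_diagonalUnitary [Nonempty n] {U : Matrix n n ℂ}
    (hU : U ∈ Matrix.unitaryGroup n ℂ) :
    (∃ ρ ∈ densityMatrices n, ∀ i, (ρ * U) i i = 0) ∨
    ∃ E ∈ diagonalUnitary n, ∃ ρ ∈ densityMatrices n, ∃ ν : ℝ, 0 < ν ∧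
      (∃ Q ∈ Matrix.unitaryGroup n ℂ, ∃ w : n → ℂ, U * E = Q * Matrix.diagonal w * Qᴴ ∧
        ∀ i, ν ≤ (w i).re) ∧
      (∀ i, star ((ρ * (U * E)) i i) = (ρ * (U * E)) i i) ∧ (ρ * (U * E)).trace = ν := by
  obtain ⟨ρ, hρ, hmin⟩ := exists_density_minimizer U
  set ν := ∑ i, ‖(ρ * U) i i‖ with hνd
  have hν0 : 0 ≤ ν := Finset.sum_nonneg fun _ _ => norm_nonneg _
  rcases hν0.eq_or_lt with h0 | hν
  · refine Or.inl ⟨ρ, hρ, fun i => ?_⟩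
    have := (Finset.sum_eq_zero_iff_of_nonneg (fun i _ => norm_nonneg ((ρ * U) i i))).1 h0.symm i
      (Finset.mem_univ i)
    simpa using this
  right
  obtain ⟨e, he1, he⟩ := exists_diagonal_contraction hν hmin
  have hquad : ∀ x : n → ℂ, ν * ∑ i, ‖x i‖ ^ 2 ≤
      (star x ⬝ᵥ (U * Matrix.diagonal e) *ᵥ x).re := by
    refine mul_sum_sq_le_of_density fun σ hσ => ?_
    rw [← mul_assoc, ← sum_diag_mul_eq_trace]
    exact he σ hσ
  -- A vanishing `e i` would make the quadratic form zero at the basis vector `i`; hence each `e i`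
  -- has a well-defined phase.
  have he0 (i) : 0 < ‖e i‖ := by
    rw [norm_pos_iff]
    intro hi
    have := hquad (Pi.single i 1)
    rw [← Matrix.mulVec_mulVec] at this
    have h1 : Matrix.diagonal e *ᵥ (Pi.single i 1 : n → ℂ) = 0 := by
      ext j
      rw [Matrix.mulVec_diagonal]
      by_cases hj : j = i
      · subst hj; simp [hi]
      · simp [hj]
    rw [h1, Matrix.mulVec_zero, dotProduct_zero, Complex.zero_re,
      Finset.sum_eq_single i (by intro j _ hj; simp [hj]) (by simp)] at this
    simp at this
    linarith
  set v : n → ℂ := fun i => e i / ‖e i‖ with hv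
  have hvn (i) : ‖v i‖ = 1 := by
    simp only [hv]
    rw [norm_div, Complex.norm_real, norm_norm, div_self (he0 i).ne']
  have hE := diagonal_mem_diagonalUnitary hvn
  have hWu : U * Matrix.diagonal v ∈ Matrix.unitaryGroup n ℂ := mul_mem hU hE.1
  set W := U * Matrix.diagonal v with hW
  have hWe : U * Matrix.diagonal e = W * Matrix.diagonal fun i => (‖e i‖ : ℂ) := by
    rw [hW, mul_assoc, Matrix.diagonal_mul_diagonal]
    congr 2
    ext i
    have : (‖e i‖ : ℂ) ≠ 0 := by exact_mod_cast (he0 i).ne'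
    simp only [hv]
    field_simp
  rw [hWe] at hquad
  have hre {x : n → ℂ} (hx : x ≠ 0) {c : ℂ} (hc : W *ᵥ x = c • x) : ν ≤ c.re :=
    le_re_of_mulVec_eq_smul hν he0 he1 hquad hx hc
  obtain ⟨Q, hQ, w, hQw⟩ := exists_unitary_diagonalization hWu fun x hx => by
    by_contra hx0
    have := hre hx0 (c := -1) (by rw [hx, neg_one_smul])
    simp at this
    linarith
  have hw (i) : ν ≤ (w i).re :=
    hre (column_ne_zero hQ i) (mulVec_column_of_conj_diagonal hQ hQw i)
  have hnorm : ∑ i, ‖(ρ * W) i i‖ = ν := by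
    rw [hνd]
    refine Finset.sum_congr rfl fun i _ => ?_
    rw [hW, ← mul_assoc, Matrix.mul_diagonal, norm_mul, hvn, mul_one]
  have htr : ν ≤ (ρ * W).trace.re := by
    have h1 := (trace_mul_nonneg_and_eq_zero hρ.1 (posSemidef_re_sub hQ hQw hw)).1
    have h2 : (ρ * Wᴴ).trace = star (ρ * W).trace := by
      rw [← Matrix.trace_conjTranspose, Matrix.conjTranspose_mul ρ, hρ.1.1.eq,
        Matrix.trace_mul_comm]
    rw [mul_sub, mul_add, Matrix.trace_sub, Matrix.trace_add, mul_smul_comm, mul_one,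
      Matrix.trace_smul, hρ.2, h2] at h1
    have h3 := (Complex.le_def.1 h1).1
    simp at h3
    linarith
  have hle (i) : ((ρ * W) i i).re ≤ ‖(ρ * W) i i‖ := Complex.re_le_norm _
  have htr' : (ρ * W).trace.re = ∑ i, ((ρ * W) i i).re := by simp [Matrix.trace]
  -- The chain `ν ≤ Re tr (ρW) ≤ ∑ |(ρW)_ii| = ν` collapses, so every diagonal entry is real and
  -- nonnegative.
  have heq : ∀ i ∈ Finset.univ, ((ρ * W) i i).re = ‖(ρ * W) i i‖ :=
    (Finset.sum_eq_sum_iff_of_le fun i _ => hle i).1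
      (le_antisymm (Finset.sum_le_sum fun i _ => hle i) (by rw [hnorm, ← htr']; exact htr))
  have hreal (i) : (ρ * W) i i = (‖(ρ * W) i i‖ : ℂ) := by
    have h1 : 0 ≤ (ρ * W) i i := Complex.re_eq_norm.1 (heq i (Finset.mem_univ i))
    exact (Complex.norm_of_nonneg' h1).symm
  refine ⟨Matrix.diagonal v, hE, ρ, hρ, ν, hν, ⟨Q, hQ, w, hQw, hw⟩, fun i => ?_, ?_⟩
  · rw [← hW, hreal, Complex.star_def, Complex.conj_ofReal]
  · rw [← hW, Matrix.trace, ← hnorm]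
    push_cast
    exact Finset.sum_congr rfl fun i _ => hreal i

end Optimal

/-! ### States on the two extreme eigenspaces -/

section Extremal

variable {n : Type*} [Fintype n] [DecidableEq n]

/-- Slackness gives `ρ (W - z)(W - z̄) = 0`, so the compression `Zᴴ ρ Z` with `Z = W - z̄` keeps
only the eigenvalue `z`. Because the diagonal of `ρW` is real, the diagonal of the compression
involves `z` only through `z + z̄`, hence is the same for `z` and `z̄`. -/
lemma exists_density_mul_eq_smul {W ρ : Matrix n n ℂ} (hW : W ∈ Matrix.unitaryGroup n ℂ)
    (hρ : ρ ∈ densityMatrices n) {ν s : ℝ} (hs : 0 < s) (hνs : ν ^ 2 + s ^ 2 = 1)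
    (h0 : ρ * (W + Wᴴ - ((2 * ν : ℝ) : ℂ) • 1) = 0)
    (hreal : ∀ i, star ((ρ * W) i i) = (ρ * W) i i) (htr : (ρ * W).trace = ν)
    {z : ℂ} (hz : star z * z = 1) (hzν : z + star z = 2 * ν) :
    ∃ τ ∈ densityMatrices n, τ * W = z • τ ∧
      ∀ i, τ i i = (2 * s ^ 2 : ℂ)⁻¹ * ((Wᴴ * ρ * W) i i + ρ i i - 2 * ν * (ρ * W) i i) := by
  have hWW : Wᴴ * W = 1 := Unitary.star_mul_self_of_mem hW
  have hWW' : W * Wᴴ = 1 := Unitary.mul_star_self_of_mem hW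
  have hρH : ρᴴ = ρ := hρ.1.1
  set Z := W - star z • 1 with hZ
  set τ := Zᴴ * ρ * Z with hτ
  have hZH : Zᴴ = Wᴴ - z • 1 := by
    simp [hZ, Matrix.conjTranspose_sub, Matrix.conjTranspose_smul]
  have hWρ : Wᴴ * ρ = (ρ * W)ᴴ := by rw [Matrix.conjTranspose_mul, hρH]
  have hquad : ρ * W * W = (2 * ν : ℂ) • (ρ * W) - ρ := by
    have h1 : ρ * (W + Wᴴ - ((2 * ν : ℝ) : ℂ) • 1) * W = 0 := by rw [h0, zero_mul]
    rw [mul_sub, mul_add, sub_mul, add_mul, mul_assoc ρ Wᴴ, hWW, mul_smul_comm, mul_one,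
      smul_mul_assoc, sub_eq_zero] at h1
    push_cast at h1
    rw [← h1, add_sub_cancel_right]
  have hτW : τ * W = z • τ := by
    have h1 : ρ * Z * W = z • (ρ * Z) := by
      simp only [hZ, mul_sub, sub_mul, mul_smul_comm, mul_one, smul_mul_assoc, hquad, smul_sub,
        smul_smul, mul_comm z, hz, one_smul, ← hzν, add_smul]
      abel
    rw [hτ, mul_assoc Zᴴ, mul_assoc, h1, mul_smul_comm]
  have hexp : τ = Wᴴ * ρ * W - star z • (Wᴴ * ρ) - z • (ρ * W) + ρ := by
    rw [hτ, hZH, hZ]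
    simp only [mul_sub, sub_mul, mul_smul_comm, mul_one, smul_mul_assoc, one_mul, smul_sub,
      smul_smul, hz, one_smul]
    abel
  have hdiag (i) : τ i i = (Wᴴ * ρ * W) i i + ρ i i - 2 * ν * (ρ * W) i i := by
    have h2 : (Wᴴ * ρ) i i = (ρ * W) i i := by
      rw [hWρ, Matrix.conjTranspose_apply, hreal]
    rw [hexp, Matrix.add_apply, Matrix.sub_apply, Matrix.sub_apply, Matrix.smul_apply,
      Matrix.smul_apply, h2, smul_eq_mul, smul_eq_mul]
    linear_combination -(ρ * W) i i * hzν
  have hνs' : (ν : ℂ) ^ 2 + (s : ℂ) ^ 2 = 1 := by exact_mod_cast hνs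
  have hs0 : (s : ℂ) ≠ 0 := by exact_mod_cast hs.ne'
  have htrτ : τ.trace = 2 * s ^ 2 := by
    have h1 : (Wᴴ * ρ * W).trace = 1 := by rw [Matrix.trace_mul_cycle, hWW', one_mul, hρ.2]
    have h2 : τ.trace = (Wᴴ * ρ * W).trace + ρ.trace - 2 * ν * (ρ * W).trace := by
      simp only [Matrix.trace, Matrix.diag_apply, hdiag, Finset.sum_sub_distrib,
        Finset.sum_add_distrib, Finset.mul_sum]
    rw [h2, h1, hρ.2, htr]
    linear_combination -2 * hνs'
  refine ⟨(2 * s ^ 2 : ℂ)⁻¹ • τ, ⟨?_, ?_⟩, ?_, fun i => ?_⟩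
  · refine (hρ.1.conjTranspose_mul_mul_same Z).smul ?_
    have : (0 : ℝ) ≤ (2 * s ^ 2)⁻¹ := by positivity
    have h := Complex.zero_le_real.2 this
    push_cast at h
    exact h
  · rw [Matrix.trace_smul, htrτ, smul_eq_mul]
    field_simp
  · rw [smul_mul_assoc, hτW, smul_comm]
  · rw [Matrix.smul_apply, smul_eq_mul, hdiag]

lemma exists_arg_le {w : ℂ} (hw : ‖w‖ = 1) {ν : ℝ} (hν : ν ≤ w.re) :
    ∃ t : ℝ, |t| ≤ Real.arccos ν ∧ w = Complex.exp (t * Complex.I) := by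
  refine ⟨w.arg, ?_, ?_⟩
  · have h1 : Real.cos |w.arg| = w.re := by
      rw [Real.cos_abs, Complex.cos_arg (by rw [← norm_ne_zero_iff, hw]; exact one_ne_zero), hw,
        div_one]
    rw [← Real.arccos_cos (abs_nonneg w.arg) (Complex.abs_arg_le_pi w), h1]
    exact Real.arccos_le_arccos hν
  · have := Complex.norm_mul_exp_arg_mul_I w
    rw [hw, Complex.ofReal_one, one_mul] at this
    exact this.symm

lemma exists_extremal_states [Nonempty n] {W Q ρ : Matrix n n ℂ} {w : n → ℂ} {ν : ℝ}
    (hW : W ∈ Matrix.unitaryGroup n ℂ) (hQ : Q ∈ Matrix.unitaryGroup n ℂ)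
    (hWQ : W = Q * Matrix.diagonal w * Qᴴ) (hν : 0 < ν) (hw : ∀ i, ν ≤ (w i).re)
    (hρ : ρ ∈ densityMatrices n) (hreal : ∀ i, star ((ρ * W) i i) = (ρ * W) i i)
    (htr : (ρ * W).trace = ν) :
    ∃ θ : ℝ, 0 ≤ θ ∧ θ < Real.pi / 2 ∧
      (∀ i, ∃ t : ℝ, |t| ≤ θ ∧ w i = Complex.exp (t * Complex.I)) ∧
      ∃ ρ₁ ∈ densityMatrices n, ∃ ρ₂ ∈ densityMatrices n, (∀ i, ρ₁ i i = ρ₂ i i) ∧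
        ρ₁ * W = Complex.exp (θ * Complex.I) • ρ₁ ∧
        ρ₂ * W = Complex.exp ((-θ : ℝ) * Complex.I) • ρ₂ := by
  have hw1 := norm_eq_one_of_conj_diagonal hW hQ hWQ
  have hν1 : ν ≤ 1 := by
    obtain ⟨i⟩ := ‹Nonempty n›
    exact (hw i).trans ((Complex.re_le_norm _).trans (hw1 i).le)
  have hcos : Real.cos (Real.arccos ν) = ν := Real.cos_arccos (by linarith) hν1
  refine ⟨Real.arccos ν, Real.arccos_nonneg ν, Real.arccos_lt_pi_div_two.2 hν,
    fun i => exists_arg_le (hw1 i) (hw i), ?_⟩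
  -- At `ν = 1` the normalisation `2 s²` degenerates, but then `W = 1` and `ρ` itself serves as both
  -- states.
  rcases hν1.eq_or_lt with rfl | hν1
  · have hw0 : w = 1 := by
      ext i
      obtain ⟨t, ht, hwt⟩ := exists_arg_le (hw1 i) (hw i)
      rw [Real.arccos_one, abs_nonpos_iff] at ht
      simp [hwt, ht]
    have hW1 : W = 1 := by
      have hQQ : Q * Qᴴ = 1 := Unitary.mul_star_self_of_mem hQ
      rw [hWQ, hw0, Matrix.diagonal_one', mul_one, hQQ]
    exact ⟨ρ, hρ, ρ, hρ, fun _ => rfl, by simp [hW1], by simp [hW1]⟩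
  · have h0 := (trace_mul_nonneg_and_eq_zero hρ.1 (posSemidef_re_sub hQ hWQ hw)).2 (by
      have h2 : (ρ * Wᴴ).trace = star (ρ * W).trace := by
        rw [← Matrix.trace_conjTranspose, Matrix.conjTranspose_mul ρ, hρ.1.1.eq,
          Matrix.trace_mul_comm]
      rw [mul_sub, mul_add, Matrix.trace_sub, Matrix.trace_add, mul_smul_comm, mul_one,
        Matrix.trace_smul, hρ.2, h2, htr, Complex.star_def, Complex.conj_ofReal]
      push_cast
      simp
      ring)
    have hνs : ν ^ 2 + Real.sin (Real.arccos ν) ^ 2 = 1 := by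
      have := Real.cos_sq_add_sin_sq (Real.arccos ν)
      rwa [hcos] at this
    have hs : 0 < Real.sin (Real.arccos ν) :=
      Real.sin_pos_of_pos_of_lt_pi (Real.arccos_pos.2 hν1)
        ((Real.arccos_lt_pi_div_two.2 hν).trans (by linarith [Real.pi_pos]))
    have hstar (t : ℝ) :
        star (Complex.exp (t * Complex.I)) = Complex.exp ((-t : ℝ) * Complex.I) := by
      rw [Complex.star_def, ← Complex.exp_conj]
      simp
    have hz (t : ℝ) : star (Complex.exp (t * Complex.I)) * Complex.exp (t * Complex.I) = 1 := by
      rw [hstar, ← Complex.exp_add]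
      simp
    have hzν (t : ℝ) (ht : Real.cos t = ν) :
        Complex.exp (t * Complex.I) + star (Complex.exp (t * Complex.I)) = 2 * ν := by
      rw [Complex.star_def, Complex.add_conj, Complex.exp_ofReal_mul_I_re, ht]
      push_cast
      rfl
    obtain ⟨τ₁, hτ₁, h₁, hd₁⟩ := exists_density_mul_eq_smul hW hρ hs hνs h0 hreal htr (hz _)
      (hzν _ hcos)
    obtain ⟨τ₂, hτ₂, h₂, hd₂⟩ := exists_density_mul_eq_smul hW hρ hs hνs h0 hreal htr (hz _)
      (hzν (-Real.arccos ν) (by rw [Real.cos_neg, hcos]))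
    exact ⟨τ₁, hτ₁, τ₂, hτ₂, fun i => by rw [hd₁, hd₂], h₁, h₂⟩

end Extremal

/-! ### Tensor powers and the attainable overlaps -/

section Tensor

variable {n : Type*} [Fintype n] [DecidableEq n] {N : ℕ}

/-- The tensor product of a family of matrices in the product basis. -/
def tensorFamily (A : Fin N → Matrix n n ℂ) : Matrix (Fin N → n) (Fin N → n) ℂ :=
  fun f g => ∏ t, A t (f t) (g t)

omit [DecidableEq n] in
lemma tensorFamily_mul (A B : Fin N → Matrix n n ℂ) :
    tensorFamily A * tensorFamily B = tensorFamily fun t => A t * B t := by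
  ext f g
  simp only [Matrix.mul_apply, tensorFamily, Finset.prod_univ_sum, Fintype.piFinset_univ,
    Finset.prod_mul_distrib]

omit [Fintype n] [DecidableEq n] in
lemma tensorFamily_conjTranspose (A : Fin N → Matrix n n ℂ) :
    (tensorFamily A)ᴴ = tensorFamily fun t => (A t)ᴴ := by
  ext f g
  simp [tensorFamily]

omit [Fintype n] in
lemma tensorFamily_diagonal (v : Fin N → n → ℂ) :
    (tensorFamily fun t => Matrix.diagonal (v t)) =
      Matrix.diagonal fun f : Fin N → n => ∏ t, v t (f t) := by
  ext f g
  by_cases h : f = g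
  · subst h; simp [tensorFamily]
  · obtain ⟨t, ht⟩ := Function.ne_iff.1 h
    rw [Matrix.diagonal_apply_ne _ h]
    exact Finset.prod_eq_zero (Finset.mem_univ t) (Matrix.diagonal_apply_ne _ ht)

omit [DecidableEq n] in
lemma trace_tensorFamily (A : Fin N → Matrix n n ℂ) :
    (tensorFamily A).trace = ∏ t, (A t).trace := by
  simp only [Matrix.trace, Matrix.diag_apply, tensorFamily, Finset.prod_univ_sum,
    Fintype.piFinset_univ]

omit [Fintype n] [DecidableEq n] in
lemma tensorFamily_smul (c : Fin N → ℂ) (A : Fin N → Matrix n n ℂ) :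
    (tensorFamily fun t => c t • A t) = (∏ t, c t) • tensorFamily A := by
  ext f g
  simp [tensorFamily, Finset.prod_mul_distrib]

lemma tensorFamily_mem_densityMatrices {A : Fin N → Matrix n n ℂ}
    (hA : ∀ t, A t ∈ densityMatrices n) : tensorFamily A ∈ densityMatrices (Fin N → n) := by
  refine ⟨?_, by simp [trace_tensorFamily, fun t => (hA t).2]⟩
  choose B hB using fun t => exists_conjTranspose_mul_self_eq (hA t).1
  have : tensorFamily A = (tensorFamily B)ᴴ * tensorFamily B := by
    rw [tensorFamily_conjTranspose, tensorFamily_mul]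
    congr 1
    ext1 t
    exact hB t
  rw [this]
  exact Matrix.posSemidef_conjTranspose_mul_self _

omit [Fintype n] [DecidableEq n] in
lemma tensorPower_eq (A : Matrix n n ℂ) : tensorPower N A = tensorFamily fun _ => A := rfl

omit [Fintype n] in
lemma tensorPower_one : tensorPower N (1 : Matrix n n ℂ) = 1 := by
  rw [tensorPower_eq, ← Matrix.diagonal_one, tensorFamily_diagonal]
  simp

omit [DecidableEq n] in
lemma tensorPower_mul (A B : Matrix n n ℂ) :
    tensorPower N (A * B) = tensorPower N A * tensorPower N B := by
  simp only [tensorPower_eq, tensorFamily_mul]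

omit [Fintype n] [DecidableEq n] in
lemma tensorPower_conjTranspose (A : Matrix n n ℂ) :
    tensorPower N Aᴴ = (tensorPower N A)ᴴ := by
  simp only [tensorPower_eq, tensorFamily_conjTranspose]

lemma tensorPower_mem_unitaryGroup {A : Matrix n n ℂ} (hA : A ∈ Matrix.unitaryGroup n ℂ) :
    tensorPower N A ∈ Matrix.unitaryGroup (Fin N → n) ℂ := by
  have h : A * Aᴴ = 1 := Unitary.mul_star_self_of_mem hA
  rw [Matrix.mem_unitaryGroup_iff, Matrix.star_eq_conjTranspose, ← tensorPower_conjTranspose,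
    ← tensorPower_mul, h, tensorPower_one]

lemma tensorPower_mem_diagonalUnitary {E : Matrix n n ℂ} (hE : E ∈ diagonalUnitary n) :
    tensorPower N E ∈ diagonalUnitary (Fin N → n) := by
  refine ⟨tensorPower_mem_unitaryGroup hE.1, ?_⟩
  rw [tensorPower_eq, ← hE.2.diagonal_diag, tensorFamily_diagonal]
  exact Matrix.isDiag_diagonal _

/-- The circle with centre `cos α` and radius `sin α` has the chord from `e^{-iα}` to `e^{iα}` as
diameter; for `α ≤ π/2` its disc covers the whole arc. -/
lemma norm_exp_sub_cos_le {t α : ℝ} (ht : |t| ≤ α) (hα : α ≤ Real.pi / 2) :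
    ‖Complex.exp (t * Complex.I) - (Real.cos α : ℂ)‖ ≤ Real.sin α := by
  have hα0 : 0 ≤ α := (abs_nonneg t).trans ht
  have hcosα : 0 ≤ Real.cos α := Real.cos_nonneg_of_mem_Icc ⟨by linarith [Real.pi_pos], hα⟩
  have hsinα : 0 ≤ Real.sin α :=
    Real.sin_nonneg_of_nonneg_of_le_pi hα0 (by linarith [Real.pi_pos])
  have hc : Real.cos α ≤ Real.cos t := by
    rw [← Real.cos_abs t]
    exact Real.cos_le_cos_of_nonneg_of_le_pi (abs_nonneg t) (by linarith [Real.pi_pos]) ht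
  rw [← sq_le_sq₀ (norm_nonneg _) hsinα, Complex.sq_norm, Complex.normSq_apply, Complex.sub_re,
    Complex.sub_im, Complex.exp_ofReal_mul_I_re, Complex.exp_ofReal_mul_I_im, Complex.ofReal_re,
    Complex.ofReal_im]
  nlinarith [Real.sin_sq_add_cos_sq t, Real.sin_sq_add_cos_sq α,
    mul_le_mul_of_nonneg_left hc hcosα]

lemma norm_tensorPower_sub_le {W Q : Matrix n n ℂ} {w : n → ℂ} {θ : ℝ}
    (hQ : Q ∈ Matrix.unitaryGroup n ℂ) (hWQ : W = Q * Matrix.diagonal w * Qᴴ)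
    (hw : ∀ i, ∃ t : ℝ, |t| ≤ θ ∧ w i = Complex.exp (t * Complex.I)) (hθ0 : 0 ≤ θ)
    (hθ : N * θ ≤ Real.pi / 2) :
    ‖tensorPower N W - (Real.cos (N * θ) : ℂ) • 1‖ ≤ Real.sin (N * θ) := by
  choose t ht hwt using hw
  have hQN := tensorPower_mem_unitaryGroup (N := N) hQ
  have hQQ : tensorPower N Q * (tensorPower N Q)ᴴ = 1 := Unitary.mul_star_self_of_mem hQN
  have h1 : tensorPower N W - (Real.cos (N * θ) : ℂ) • 1 = tensorPower N Q *
      Matrix.diagonal (fun f : Fin N → n => ∏ a, w (f a) - (Real.cos (N * θ) : ℂ)) *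
        (tensorPower N Q)ᴴ := by
    have h2 : Matrix.diagonal (fun f : Fin N → n => ∏ a, w (f a) - (Real.cos (N * θ) : ℂ)) =
        tensorPower N (Matrix.diagonal w) - (Real.cos (N * θ) : ℂ) • 1 := by
      rw [tensorPower_eq, tensorFamily_diagonal, Matrix.smul_one_eq_diagonal,
        Matrix.diagonal_sub]
    rw [h2, mul_sub, sub_mul, mul_smul_comm, mul_one, smul_mul_assoc, hQQ, hWQ, tensorPower_mul,
      tensorPower_mul, tensorPower_conjTranspose]
  rw [h1]
  have hpos : 0 ≤ (N : ℝ) * θ := by positivity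
  refine (norm_mul_mul_star_le hQN _).trans (norm_diagonal_le
    (Real.sin_nonneg_of_nonneg_of_le_pi hpos (by linarith [Real.pi_pos])) fun f => ?_)
  have h3 : ∏ a, w (f a) = Complex.exp ((∑ a, t (f a) : ℝ) * Complex.I) := by
    simp only [hwt, ← Complex.exp_sum, ← Finset.sum_mul]
    push_cast
    rfl
  rw [h3]
  refine norm_exp_sub_cos_le ?_ hθ
  calc |∑ a, t (f a)| ≤ ∑ a, |t (f a)| := Finset.abs_sum_le_sum_abs _ _
    _ ≤ ∑ _a : Fin N, θ := Finset.sum_le_sum fun a _ => ht _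
    _ = N * θ := by simp

/-- The values `μ` for which some state `ρ` with diagonal `p` satisfies `diag (W† ρ W) = p` and
`diag (ρ W) = μ p`. -/
def diagonalOverlaps (W : Matrix n n ℂ) (p : n → ℂ) : Set ℂ :=
  {μ | ∃ ρ ∈ densityMatrices n, ∀ i, ρ i i = p i ∧ (Wᴴ * ρ * W) i i = p i ∧
    (ρ * W) i i = μ * p i}

/-- Once `p` is fixed, all conditions are affine in the pair `(ρ, μ)`; this is why `ρ₁` and `ρ₂`
must share their diagonal. -/
lemma convex_diagonalOverlaps (W : Matrix n n ℂ) (p : n → ℂ) :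
    Convex ℝ (diagonalOverlaps W p) := by
  rintro μ ⟨σ, hσ, hσp⟩ κ ⟨τ, hτ, hτp⟩ a b ha hb hab
  have hab' : (a : ℂ) + b = 1 := by exact_mod_cast hab
  refine ⟨(a : ℂ) • σ + (b : ℂ) • τ, ⟨?_, ?_⟩, fun i => ⟨?_, ?_, ?_⟩⟩
  · exact (hσ.1.smul (Complex.zero_le_real.2 ha)).add (hτ.1.smul (Complex.zero_le_real.2 hb))
  · rw [Matrix.trace_add, Matrix.trace_smul, Matrix.trace_smul, hσ.2, hτ.2]
    simpa using hab'
  · rw [Matrix.add_apply, Matrix.smul_apply, Matrix.smul_apply, (hσp i).1, (hτp i).1, smul_eq_mul,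
      smul_eq_mul, ← add_mul, hab', one_mul]
  · rw [mul_add, add_mul, mul_smul_comm, mul_smul_comm, smul_mul_assoc, smul_mul_assoc,
      Matrix.add_apply, Matrix.smul_apply, Matrix.smul_apply, (hσp i).2.1, (hτp i).2.1,
      smul_eq_mul, smul_eq_mul, ← add_mul, hab', one_mul]
  · rw [add_mul, smul_mul_assoc, smul_mul_assoc, Matrix.add_apply, Matrix.smul_apply,
      Matrix.smul_apply, (hσp i).2.2, (hτp i).2.2, smul_eq_mul, smul_eq_mul, Complex.real_smul,
      Complex.real_smul]
    ring

lemma two_mul_le_diamondNorm_of_mem_diagonalOverlaps {W : Matrix n n ℂ} {p : n → ℂ}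
    (hW : W ∈ Matrix.unitaryGroup n ℂ) {c s : ℝ} (hc : (c : ℂ) ∈ diagonalOverlaps W p)
    (hcs : c ^ 2 + s ^ 2 = 1) :
    2 * s ≤ diamondNorm (vonNeumannMeasurement W - vonNeumannMeasurement 1) := by
  obtain ⟨ρ, hρ, h⟩ := hc
  refine two_mul_le_diamondNorm_of_diag_eq hW hρ.1 hρ.2 (μ := c) ?_
    (fun i => by rw [(h i).1, (h i).2.1]) (fun i => by rw [(h i).1, (h i).2.2])
  have : (c : ℂ) ^ 2 + (s : ℂ) ^ 2 = 1 := by exact_mod_cast hcs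
  rw [Complex.star_def, Complex.conj_ofReal]
  linear_combination this

lemma exp_mem_diagonalOverlaps_tensorPower {W : Matrix n n ℂ} {p : n → ℂ}
    {A : Fin N → Matrix n n ℂ} {φ : Fin N → ℝ} (hA : ∀ t, A t ∈ densityMatrices n)
    (hp : ∀ t i, A t i i = p i) (hφ : ∀ t, A t * W = Complex.exp (φ t * Complex.I) • A t) :
    Complex.exp ((∑ t, φ t : ℝ) * Complex.I) ∈
      diagonalOverlaps (tensorPower N W) fun f => ∏ t, p (f t) := by
  have hexp : Complex.exp ((∑ t, φ t : ℝ) * Complex.I) = ∏ t, Complex.exp (φ t * Complex.I) := by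
    rw [← Complex.exp_sum, ← Finset.sum_mul]
    push_cast
    rfl
  have hmul : tensorFamily A * tensorPower N W =
      Complex.exp ((∑ t, φ t : ℝ) * Complex.I) • tensorFamily A := by
    rw [hexp, tensorPower_eq, tensorFamily_mul, ← tensorFamily_smul]
    simp only [hφ]
  have hd (f : Fin N → n) : tensorFamily A f f = ∏ t, p (f t) :=
    Finset.prod_congr rfl fun t _ => hp t (f t)
  have hσ := tensorFamily_mem_densityMatrices hA
  have hconj : (tensorPower N W)ᴴ * tensorFamily A * tensorPower N W = tensorFamily A := by
    have h1 : (tensorPower N W)ᴴ * tensorFamily A =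
        star (Complex.exp ((∑ t, φ t : ℝ) * Complex.I)) • tensorFamily A := by
      have := congrArg Matrix.conjTranspose hmul
      rwa [Matrix.conjTranspose_mul, Matrix.conjTranspose_smul, hσ.1.1.eq] at this
    rw [h1, smul_mul_assoc, hmul, smul_smul, Complex.star_def, Complex.conj_mul',
      Complex.norm_exp_ofReal_mul_I]
    simp
  refine ⟨tensorFamily A, hσ, fun f => ⟨hd f, ?_, ?_⟩⟩
  · rw [hconj, hd]
  · rw [hmul, Matrix.smul_apply, smul_eq_mul, hd]

lemma sum_ite_lt (θ : ℝ) {k : ℕ} (hk : k ≤ N) :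
    ∑ t : Fin N, (if (t : ℕ) < k then θ else -θ) = (2 * (k : ℝ) - N) * θ := by
  rw [Fin.sum_univ_eq_sum_range (fun i => if i < k then θ else -θ) N]
  obtain ⟨m, rfl⟩ := Nat.exists_eq_add_of_le hk
  rw [Finset.sum_range_add, Finset.sum_congr rfl (g := fun _ => θ) (by
    intro i hi; rw [if_pos (Finset.mem_range.1 hi)])]
  simp
  ring

/-- Using `ρ₁` in `m + j` or in `j` of the `N = m + 2j` factors gives phases `mθ` and `-mθ`; their
average is `cos mθ`. -/
lemma cos_mem_diagonalOverlaps_tensorPower {W ρ₁ ρ₂ : Matrix n n ℂ} {θ : ℝ}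
    (hρ₁ : ρ₁ ∈ densityMatrices n) (hρ₂ : ρ₂ ∈ densityMatrices n) (hd : ∀ i, ρ₁ i i = ρ₂ i i)
    (h₁ : ρ₁ * W = Complex.exp (θ * Complex.I) • ρ₁)
    (h₂ : ρ₂ * W = Complex.exp ((-θ : ℝ) * Complex.I) • ρ₂) {m j : ℕ} (hm : m + 2 * j = N) :
    (Real.cos (m * θ) : ℂ) ∈ diagonalOverlaps (tensorPower N W) fun f => ∏ t, ρ₁ (f t) (f t) := by
  have key {k : ℕ} (hk : k ≤ N) : Complex.exp (((2 * (k : ℝ) - N) * θ : ℝ) * Complex.I) ∈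
      diagonalOverlaps (tensorPower N W) fun f => ∏ t, ρ₁ (f t) (f t) := by
    rw [← sum_ite_lt θ hk]
    refine exp_mem_diagonalOverlaps_tensorPower (p := fun i => ρ₁ i i)
      (A := fun t => if (t : ℕ) < k then ρ₁ else ρ₂) ?_ ?_ ?_
    · intro t; by_cases h : (t : ℕ) < k <;> simp [h, hρ₁, hρ₂]
    · intro t i; by_cases h : (t : ℕ) < k <;> simp [h, hd]
    · intro t
      by_cases h : (t : ℕ) < k
      · simpa only [h, if_true] using h₁
      · simpa only [h, if_false] using h₂
  have hN : (N : ℝ) = m + 2 * j := by exact_mod_cast hm.symm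
  have e1 := key (k := m + j) (by omega)
  have e2 := key (k := j) (by omega)
  have a1 : (2 * ((m + j : ℕ) : ℝ) - N) * θ = m * θ := by rw [hN]; push_cast; ring
  have a2 : (2 * (j : ℝ) - N) * θ = -(m * θ) := by rw [hN]; ring
  rw [a1] at e1
  rw [a2] at e2
  have h := convex_diagonalOverlaps _ _ e1 e2 (a := 1 / 2) (b := 1 / 2) (by norm_num)
    (by norm_num) (by norm_num)
  convert h using 1
  rw [Complex.real_smul, Complex.real_smul, Complex.ofReal_cos, Complex.cos]
  push_cast
  ring_nf

lemma exists_cos_nonpos {θ : ℝ} (hθ : θ < Real.pi / 2) (h : Real.pi / 2 ≤ N * θ) :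
    ∃ m j : ℕ, m + 2 * j = N ∧ Real.cos (m * θ) ≤ 0 := by
  by_contra! hcon
  -- The angles with the parity of `N` advance by `2θ < π`, so they cannot jump over `[π/2, 3π/2]`,
  -- where the cosine is nonpositive.
  have key : ∀ m : ℕ, ∀ j : ℕ, m + 2 * j = N → m * θ < Real.pi / 2 := by
    intro m
    induction m using Nat.twoStepInduction with
    | zero => intro _ _; simpa using Real.pi_pos
    | one => intro _ _; simpa using hθ
    | more m ih _ =>
      intro j hj
      have h1 := ih (j + 1) (by omega)
      have h2 := hcon (m + 2) j hj
      by_contra! h3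
      push_cast at h2 h3
      exact absurd (Real.cos_nonpos_of_pi_div_two_le_of_le h3 (by linarith)) (not_le.2 h2)
  exact absurd (key N 0 (by omega)) (not_lt.2 h)

lemma zero_mem_diagonalOverlaps_tensorPower {W ρ₁ ρ₂ : Matrix n n ℂ} {θ : ℝ}
    (hρ₁ : ρ₁ ∈ densityMatrices n) (hρ₂ : ρ₂ ∈ densityMatrices n) (hd : ∀ i, ρ₁ i i = ρ₂ i i)
    (h₁ : ρ₁ * W = Complex.exp (θ * Complex.I) • ρ₁)
    (h₂ : ρ₂ * W = Complex.exp ((-θ : ℝ) * Complex.I) • ρ₂) (hθ0 : 0 ≤ θ)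
    (hθ : θ < Real.pi / 2) (hN : Real.pi / 2 ≤ N * θ) :
    ((0 : ℝ) : ℂ) ∈ diagonalOverlaps (tensorPower N W) fun f => ∏ t, ρ₁ (f t) (f t) := by
  set S : Set ℝ := Complex.ofRealCLM ⁻¹'
    diagonalOverlaps (tensorPower N W) fun f => ∏ t, ρ₁ (f t) (f t)
  have hS : Convex ℝ S :=
    (convex_diagonalOverlaps _ _).linear_preimage Complex.ofRealCLM.toLinearMap
  obtain ⟨m, j, hmj, hcos⟩ := exists_cos_nonpos hθ hN
  have e1 : Real.cos (m * θ) ∈ S :=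
    cos_mem_diagonalOverlaps_tensorPower hρ₁ hρ₂ hd h₁ h₂ hmj
  -- The smallest index of the right parity is `0` or `1`, and its cosine is nonnegative; convexity
  -- then supplies the value `0` in between.
  have e2 : Real.cos ((N % 2 : ℕ) * θ) ∈ S :=
    cos_mem_diagonalOverlaps_tensorPower hρ₁ hρ₂ hd h₁ h₂ (Nat.mod_add_div N 2)
  refine hS.ordConnected.out e1 e2 ⟨hcos, Real.cos_nonneg_of_mem_Icc ⟨?_, ?_⟩⟩
  · have : 0 ≤ ((N % 2 : ℕ) : ℝ) * θ := by positivity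
    linarith [Real.pi_pos]
  · have : ((N % 2 : ℕ) : ℝ) ≤ 1 := by exact_mod_cast Nat.lt_succ_iff.1 (Nat.mod_lt N two_pos)
    nlinarith

end Tensor

/-! ### Matching the bounds for the parallel scheme -/

section ParallelScheme

variable {n : Type*} [Fintype n] [DecidableEq n]

lemma one_mem_diagonalUnitary : (1 : Matrix n n ℂ) ∈ diagonalUnitary n :=
  ⟨one_mem _, Matrix.isDiag_one⟩

lemma diamondNorm_unitaryChannel_sub_le_two {W : Matrix n n ℂ}
    (hW : W ∈ Matrix.unitaryGroup n ℂ) :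
    diamondNorm (unitaryChannel W - unitaryChannel 1) ≤ 2 :=
  diamondNorm_le zero_le_two fun _ hX => traceNorm_ampliate_unitaryChannel_sub_le_two hW hX

theorem diamondNorm_tensorPower_le_of_spectral_gap [Nonempty n] {W Q ρ : Matrix n n ℂ} {w : n → ℂ}
    {ν : ℝ} (N : ℕ) (hW : W ∈ Matrix.unitaryGroup n ℂ) (hQ : Q ∈ Matrix.unitaryGroup n ℂ)
    (hWQ : W = Q * Matrix.diagonal w * Qᴴ) (hν : 0 < ν) (hw : ∀ i, ν ≤ (w i).re)
    (hρ : ρ ∈ densityMatrices n) (hreal : ∀ i, star ((ρ * W) i i) = (ρ * W) i i)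
    (htr : (ρ * W).trace = ν) :
    diamondNorm (unitaryChannel (tensorPower N W) - unitaryChannel 1) ≤
      diamondNorm (vonNeumannMeasurement (tensorPower N W) - vonNeumannMeasurement 1) := by
  have hWN := tensorPower_mem_unitaryGroup (N := N) hW
  obtain ⟨θ, hθ0, hθ, hwθ, ρ₁, hρ₁, ρ₂, hρ₂, hd, h₁, h₂⟩ :=
    exists_extremal_states hW hQ hWQ hν hw hρ hreal htr
  rcases le_total (N * θ) (Real.pi / 2) with hN | hN
  · calc _ ≤ 2 * ‖tensorPower N W - (Real.cos (N * θ) : ℂ) • 1‖ :=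
          diamondNorm_unitaryChannel_sub_le hWN _
      _ ≤ 2 * Real.sin (N * θ) := by
          gcongr
          exact norm_tensorPower_sub_le hQ hWQ hwθ hθ0 hN
      _ ≤ _ := two_mul_le_diamondNorm_of_mem_diagonalOverlaps hWN
          (cos_mem_diagonalOverlaps_tensorPower hρ₁ hρ₂ hd h₁ h₂ (m := N) (j := 0) rfl)
          (Real.cos_sq_add_sin_sq _)
  · calc _ ≤ (2 : ℝ) * 1 := by
          rw [mul_one]; exact diamondNorm_unitaryChannel_sub_le_two hWN
      _ ≤ _ := two_mul_le_diamondNorm_of_mem_diagonalOverlaps hWN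
          (zero_mem_diagonalOverlaps_tensorPower hρ₁ hρ₂ hd h₁ h₂ hθ0 hθ hN) (by norm_num)

theorem exists_diagonalUnitary_diamondNorm_tensorPower_le (N : ℕ) {U : Matrix n n ℂ}
    (hU : U ∈ Matrix.unitaryGroup n ℂ) :
    ∃ E ∈ diagonalUnitary n,
      diamondNorm (unitaryChannel (tensorPower N U * tensorPower N E) - unitaryChannel 1) ≤
        diamondNorm (vonNeumannMeasurement (tensorPower N U) - vonNeumannMeasurement 1) := by
  have htriv (h : tensorPower N U = 1) :
      diamondNorm (unitaryChannel (tensorPower N U * tensorPower N (1 : Matrix n n ℂ)) -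
        unitaryChannel 1) ≤
      diamondNorm (vonNeumannMeasurement (tensorPower N U) - vonNeumannMeasurement 1) := by
    rw [h, tensorPower_one, mul_one]
    refine (diamondNorm_unitaryChannel_sub_le (one_mem _) 1).trans ?_
    rw [one_smul, sub_self, norm_zero, mul_zero]
    exact diamondNorm_nonneg _
  rcases isEmpty_or_nonempty n with hn | hn
  · exact ⟨1, one_mem_diagonalUnitary, htriv (by
      rw [Subsingleton.elim U 1, tensorPower_one])⟩
  rcases exists_optimal_diagonalUnitary hU with
    ⟨ρ, hρ, h0⟩ | ⟨E, hE, ρ, hρ, ν, hν, ⟨Q, hQ, w, hWQ, hw⟩, hreal, htr⟩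
  · refine ⟨1, one_mem_diagonalUnitary, ?_⟩
    have hUN := tensorPower_mem_unitaryGroup (N := N) hU
    -- A vanishing diagonal of `ρ U` passes to the tensor power only if there is at least one
    -- factor; for `N = 0` the power is the `1 × 1` identity and both norms vanish.
    rcases Nat.eq_zero_or_pos N with rfl | hN
    · refine htriv ?_
      ext f g
      rw [Subsingleton.elim f g, Matrix.one_apply_eq]
      simp [tensorPower]
    · rw [tensorPower_one, mul_one]
      have hρN := tensorFamily_mem_densityMatrices (N := N) (A := fun _ => ρ) fun _ => hρ
      refine (diamondNorm_unitaryChannel_sub_le_two hUN).trans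
        (two_le_diamondNorm_of_diag_eq_zero hUN hρN.1 hρN.2 fun f => ?_)
      rw [tensorPower_eq, tensorFamily_mul]
      exact Finset.prod_eq_zero (Finset.mem_univ ⟨0, hN⟩) (h0 _)
  · refine ⟨E, hE, ?_⟩
    rw [← vonNeumannMeasurement_mul_diagonalUnitary (tensorPower N U)
      (tensorPower_mem_diagonalUnitary hE), ← tensorPower_mul]
    exact diamondNorm_tensorPower_le_of_spectral_gap N (mul_mem hU hE.1) hQ hWQ hν hw hρ hreal htr

end ParallelScheme

end VonNeumannDiscrimination

end

theorem mainTheorem4 (d N : ℕ) (U : Matrix (Fin d) (Fin d) ℂ)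
    (hU : U ∈ Matrix.unitaryGroup (Fin d) ℂ) :
    IsLeast
      {r : ℝ | ∃ E ∈ VonNeumannDiscrimination.diagonalUnitary (Fin d),
        r = VonNeumannDiscrimination.diamondNorm
          (VonNeumannDiscrimination.unitaryChannel
              (VonNeumannDiscrimination.tensorPower N U * VonNeumannDiscrimination.tensorPower N E)
            - VonNeumannDiscrimination.unitaryChannel 1)}
      (VonNeumannDiscrimination.diamondNorm
        (VonNeumannDiscrimination.vonNeumannMeasurement (VonNeumannDiscrimination.tensorPower N U)
          - VonNeumannDiscrimination.vonNeumannMeasurement 1)) ∧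
    IsLeast
      {r : ℝ | ∃ F ∈ VonNeumannDiscrimination.diagonalUnitary (Fin N → Fin d),
        r = VonNeumannDiscrimination.diamondNorm
          (VonNeumannDiscrimination.unitaryChannel (VonNeumannDiscrimination.tensorPower N U * F)
            - VonNeumannDiscrimination.unitaryChannel 1)}
      (VonNeumannDiscrimination.diamondNorm
        (VonNeumannDiscrimination.vonNeumannMeasurement (VonNeumannDiscrimination.tensorPower N U)
          - VonNeumannDiscrimination.vonNeumannMeasurement 1)) := by
  have hUN := VonNeumannDiscrimination.tensorPower_mem_unitaryGroup (N := N) hU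
  obtain ⟨E, hE, hle⟩ :=
    VonNeumannDiscrimination.exists_diagonalUnitary_diamondNorm_tensorPower_le N hU
  have hEN := VonNeumannDiscrimination.tensorPower_mem_diagonalUnitary (N := N) hE
  have heq := le_antisymm
    (VonNeumannDiscrimination.diamondNorm_vonNeumannMeasurement_sub_le hUN hEN) hle
  refine ⟨⟨⟨E, hE, heq⟩, ?_⟩, ⟨⟨_, hEN, heq⟩, ?_⟩⟩
  · rintro _ ⟨F, hF, rfl⟩
    exact VonNeumannDiscrimination.diamondNorm_vonNeumannMeasurement_sub_le hUN
      (VonNeumannDiscrimination.tensorPower_mem_diagonalUnitary hF)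
  · rintro _ ⟨F, hF, rfl⟩
    exact VonNeumannDiscrimination.diamondNorm_vonNeumannMeasurement_sub_le hUN hF
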